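/- **Model.** A task set consists of $n$ sporadic tasks $\tau_1,\dots,\tau_n$ with unique fixed priorities; $hp(k)$ and $lp(k)$ are the tasks of higher and lower priority than $\tau_k$. Task $\tau_i$ has a minimum inter-arrival time $T_i$, a relative deadline $0<D_i\le T_i$, and $m_i\ge 1$ CPU segments $C_i^j$, $2m_i-2$ memory copies $M_i^j$ and $m_i-1$ GPU segments $G_i^j$, executed in the order $C_i^0,M_i^0,G_i^0,M_i^1,C_i^1,M_i^2,G_i^1,M_i^3,\dots,C_i^{m_i-1}$. The execution time of $C_i^j$ lies in $[\check{CL}{}_i^j,\hat{CL}{}_i^j]$ and that of $M_i^j$ in $[\check{ML}{}_i^j,\hat{ML}{}_i^j]$ (lower bounds $\ge 0$). $G_i^j$ has a total work $w\in[\check{GW}{}_i^j,\hat{GW}{}_i^j]$ ($\check{GW}{}_i^j\ge 0$), a critical-path overhead $\ell\in[0,\hat{GL}{}_i^j]$ and an interleaved execution ratio $a\in[1,\alpha_i^j]$. An allocation gives each $\tau_i$ its own $2GN_i$ dedicated virtual SMs, with integers $GN_i\ge1$ and $\sum_i GN_i\le GN$, where the GPU has $2\,GN$ virtual SMs; then $G_i^j$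 starts as soon as it is available and takes time $(wa-\ell)/(2GN_i)+\ell$. A segment is available when its job is released and all previous segments of its task (including those of earlier jobs) are completed. The CPU is one processor with preemptive fixed-priority scheduling of the CPU segments, the bus uses non-preemptive fixed-priority scheduling of the memory copies, and both are work-conserving. Task $\tau_k$ is *schedulable* with the allocation if in every such execution (all admissible release times, execution times, GPU parameters, and scheduling decisions) every job of $\tau_k$ is completed at most $D_k$ after its release. **Bounds.** Put $\check{GR}{}_i^j=\check{GW}{}_i^j/(2GN_i)$ and $\hat{GR}{}_i^j=(\hat{GW}{}_i^j\alpha_i^j-\hat{GL}{}_i^j)/(2GN_i)+\hat{GL}{}_i^j$. For sequences $L,S$ put $W^h_{L,S}(t)=\sum_{j=h}^{l}L(j)+\min\bigl(L(l+1),\,t-\sum_{j=h}^{l}(L(j)+S(j))\bigr)$, where $l\ge h-1$ is the largest integer with $\sum_{j=h}^{l}(L(j)+S(j))\le t$. Then * $MW_i^h=W^h_{L,S}$ with $L(j)=\hat{ML}{}_i^{\,j \bmod (2m_i-2)}$ and $S=MS_i$; writing $r=j\bmod(2m_i-2)$, $MS_i(j)=\check{GR}{}_i^{\,r/2}$ if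 $r\ne 2m_i-3$ and $j$ is even, $MS_i(j)=\check{CL}{}_i^{\,(r+1)/2}$ if $r\neq 2m_i-3$ and $j$ is odd, $MS_i(2m_i-3)=T_i-D_i+\check{CL}{}_i^{m_i-1}+\check{CL}{}_i^0$, and $MS_i(j)=T_i-\sum_{u=0}^{2m_i-3}\hat{ML}{}_i^u-\sum_{u=1}^{m_i-2}\check{CL}{}_i^u-\sum_{u=0}^{m_i-2}\check{GR}{}_i^u$ otherwise; * $CW_i^h=W^h_{L,S}$ with $L(j)=\hat{CL}{}_i^{\,j\bmod m_i}$ and $S=CS_i$; writing $r=j\bmod m_i$, $CS_i(j)=\check{ML}{}_i^{2r}+\check{GR}{}_i^{r}+\check{ML}{}_i^{2r+1}$ if $r\ne m_i-1$, $CS_i(m_i-1)=T_i-D_i$, and $CS_i(j)=T_i-\sum_{u=0}^{m_i-1}\hat{CL}{}_i^u-\sum_{u=0}^{2m_i-3}\check{ML}{}_i^u-\sum_{u=0}^{m_i-2}\check{GR}{}_i^u$ otherwise. Let $\hat{MR}{}_k^j$, $\hat{CR}{}_k^j$ and $\hat{R2}_k$ be the smallest solutions $x\ge0$ (and $+\infty$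 if there are none) of $$x=\hat{ML}{}_k^j+\sum_{\tau_i\in hp(k)}\max_{0\le h\le 2m_i-3}MW_i^h(x)+\max_{\tau_i\in lp(k)}\max_{0\le h\le 2m_i-3}\hat{ML}{}_i^h,$$ $$x=\hat{CL}{}_k^j+\sum_{\tau_i\in hp(k)}\max_{0\le h\le m_i-1}CW_i^h(x),$$ $$x=\sum_{j=0}^{m_k-2}\hat{GR}{}_k^j+\sum_{j=0}^{2m_k-3}\hat{MR}{}_k^j+\sum_{j=0}^{m_k-1}\hat{CL}{}_k^j+\sum_{\tau_i\in hp(k)}\max_{0\le h\le m_i-1}CW_i^h(x),$$ respectively (a maximum over the empty set is $0$). Let $\hat{R1}_k=\sum_{j=0}^{m_k-2}\hat{GR}{}_k^j+\sum_{j=0}^{2m_k-3}\hat{MR}{}_k^j+\sum_{j=0}^{m_k-1}\hat{CR}{}_k^j$ and $\hat R_k=\min(\hat{R1}_k,\hat{R2}_k)$. **Statement.** For every allocation and every $k$: 1. if the tasks in $hp(k)$ are schedulable and $\hat R_k\le D_k$, then $\tau_k$ is schedulable; 2. in particular, if $\hat R_i\le D_i$ for $\tau_k$ and for all $\tau_i\in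 hp(k)$, then $\tau_k$ is schedulable. Moreover, if the grid search over $1\le GN_i\le GN-\sum_{j<i}GN_j$ ($i=1,\dots,n$) meets an allocation with $\hat R_k\le D_k$ for all $k$, then this is an allocation ($GN_i\ge1$, $\sum_i GN_i\le GN$) with which all $n$ tasks are schedulable. -/

import Mathlib

open MeasureTheory Finset

noncomputable section

namespace RTGPU

/-- A sporadic CPU-GPU task with `m` CPU segments (indices `0, …, m - 1`), `2 m - 2` memory-copy
segments (indices `0, …, 2 m - 3`) and `m - 1` GPU segments (indices `0, …, m - 2`), executed in
the order `C⁰ M⁰ G⁰ M¹ C¹ M² G¹ M³ … C^(m-1)`.  Values at other indices are irrelevant.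
`lo` and `up` mark lower and upper bounds. -/
structure Task where
  m : ℕ
  CLlo : ℕ → ℝ
  CLup : ℕ → ℝ
  MLlo : ℕ → ℝ
  MLup : ℕ → ℝ
  /-- total work of the GPU segments -/
  GWlo : ℕ → ℝ
  GWup : ℕ → ℝ
  /-- upper bound on the critical-path overhead of the GPU segments (the lower bound is `0`) -/
  GLup : ℕ → ℝ
  /-- upper bound on the interleaved execution ratio of the GPU segments (the lower bound is `1`) -/
  α : ℕ → ℝ
  /-- relative deadline -/
  D : ℝ
  /-- period, that is, minimum inter-arrival time -/
  T : ℝ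
  one_le_m : 1 ≤ m
  CL_nonneg : ∀ j < m, 0 ≤ CLlo j
  CL_le : ∀ j < m, CLlo j ≤ CLup j
  ML_nonneg : ∀ j < 2 * m - 2, 0 ≤ MLlo j
  ML_le : ∀ j < 2 * m - 2, MLlo j ≤ MLup j
  GW_nonneg : ∀ j < m - 1, 0 ≤ GWlo j
  GW_le : ∀ j < m - 1, GWlo j ≤ GWup j
  GL_nonneg : ∀ j < m - 1, 0 ≤ GLup j
  one_le_α : ∀ j < m - 1, 1 ≤ α j
  D_pos : 0 < D
  D_le_T : D ≤ T

/-- A set of `n` tasks with unique fixed task-level priorities; a smaller value of `prio` is a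
higher priority. -/
structure TaskSet (n : ℕ) where
  task : Fin n → Task
  prio : Fin n → ℕ
  prio_injective : Function.Injective prio

/-! ### The response time bounds -/

namespace Task

variable (τ : Task) (g : ℕ)

/-- Lower bound on the response time of GPU segment `j` on `2 g` dedicated virtual SMs. -/
def GRlo (j : ℕ) : ℝ := τ.GWlo j / (2 * g)

/-- Upper bound on the response time of GPU segment `j` on `2 g` dedicated virtual SMs. -/
def GRup (j : ℕ) : ℝ := (τ.GWup j * τ.α j - τ.GLup j) / (2 * g) + τ.GLup j

/-- Minimum interval-arrival time between the `j`-th and the `(j+1)`-st memory-copy segment. -/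
def MS (j : ℕ) : ℝ :=
  if j % (2 * τ.m - 2) ≠ 2 * τ.m - 3 ∧ j % 2 = 0 then
    τ.GRlo g ((j % (2 * τ.m - 2)) / 2)
  else if j % (2 * τ.m - 2) ≠ 2 * τ.m - 3 ∧ j % 2 = 1 then
    τ.CLlo ((j % (2 * τ.m - 2) + 1) / 2)
  else if j = 2 * τ.m - 3 then
    τ.T - τ.D + τ.CLlo (τ.m - 1) + τ.CLlo 0
  else
    τ.T - ∑ i ∈ range (2 * τ.m - 2), τ.MLup i - ∑ i ∈ Ico 1 (τ.m - 1), τ.CLlo i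
      - ∑ i ∈ range (τ.m - 1), τ.GRlo g i

/-- Minimum interval-arrival time between the `j`-th and the `(j+1)`-st CPU segment. -/
def CS (j : ℕ) : ℝ :=
  if j % τ.m ≠ τ.m - 1 then
    τ.MLlo (2 * (j % τ.m)) + τ.GRlo g (j % τ.m) + τ.MLlo (2 * (j % τ.m) + 1)
  else if j = τ.m - 1 then
    τ.T - τ.D
  else
    τ.T - ∑ i ∈ range τ.m, τ.CLup i - ∑ i ∈ range (2 * τ.m - 2), τ.MLlo i
      - ∑ i ∈ range (τ.m - 1), τ.GRlo g i

/-- The general workload function: `L` are the execution segments, `S` the gaps after them, `h` is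
the starting segment.  With `l = h + N - 1`, `N` is the largest number for which
`∑_{j=h}^{l} (L j + S j) ≤ t` (the sum is empty for `N = 0`). -/
def workload (L S : ℕ → ℝ) (h : ℕ) (t : ℝ) : ℝ :=
  let N : ℕ := sSup {N : ℕ | ∑ j ∈ Ico h (h + N), (L j + S j) ≤ t}
  ∑ j ∈ Ico h (h + N), L j
    + min (L (h + N)) (t - ∑ j ∈ Ico h (h + N), (L j + S j))

/-- Memory-copy workload function `MW^h(t)`. -/
def MW (h : ℕ) (t : ℝ) : ℝ :=
  workload (fun j => τ.MLup (j % (2 * τ.m - 2))) (τ.MS g) h t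

/-- CPU workload function `CW^h(t)`. -/
def CW (h : ℕ) (t : ℝ) : ℝ :=
  workload (fun j => τ.CLup (j % τ.m)) (τ.CS g) h t

/-- `max_{h ∈ [0, 2m-3]} MW^h(t)`, which is `0` for a task without memory copies. -/
def MWmax (t : ℝ) : ℝ := ⨆ h : Fin (2 * τ.m - 2), τ.MW g h t

/-- `max_{h ∈ [0, m-1]} CW^h(t)`. -/
def CWmax (t : ℝ) : ℝ := ⨆ h : Fin τ.m, τ.CW g h t

end Task

/-- The smallest solution `r ≥ 0` of `r = F r`, and `⊤` if there is none. -/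
def leastSolution (F : ℝ → EReal) : EReal :=
  sInf {x : EReal | ∃ r : ℝ, x = r ∧ 0 ≤ r ∧ (r : EReal) = F r}

namespace TaskSet

variable {n : ℕ} (ts : TaskSet n) (GN : Fin n → ℕ)

/-- The tasks with a higher priority than task `k`. -/
def hp (k : Fin n) : Finset (Fin n) := univ.filter fun i => ts.prio i < ts.prio k

/-- The longest memory-copy segment of a task with lower priority than `k` (`0` if there is
none). -/
def blocking (k : Fin n) : ℝ :=
  ⨆ i : {i : Fin n // ts.prio k < ts.prio i},
    ⨆ h : Fin (2 * (ts.task i).m - 2), (ts.task i).MLup h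

/-- Response time bound of the `j`-th memory-copy segment of task `k`. -/
def MRup (k : Fin n) (j : ℕ) : EReal :=
  leastSolution fun r =>
    (((ts.task k).MLup j + ∑ i ∈ ts.hp k, (ts.task i).MWmax (GN i) r + ts.blocking k : ℝ) : EReal)

/-- Response time bound of the `j`-th CPU segment of task `k`. -/
def CRup (k : Fin n) (j : ℕ) : EReal :=
  leastSolution fun r =>
    (((ts.task k).CLup j + ∑ i ∈ ts.hp k, (ts.task i).CWmax (GN i) r : ℝ) : EReal)

def R1up (k : Fin n) : EReal :=
  ∑ j ∈ range ((ts.task k).m - 1), (((ts.task k).GRup (GN k) j : ℝ) : EReal)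
    + ∑ j ∈ range (2 * (ts.task k).m - 2), ts.MRup GN k j
    + ∑ j ∈ range (ts.task k).m, ts.CRup GN k j

def R2up (k : Fin n) : EReal :=
  leastSolution fun r =>
    ∑ j ∈ range ((ts.task k).m - 1), (((ts.task k).GRup (GN k) j : ℝ) : EReal)
      + ∑ j ∈ range (2 * (ts.task k).m - 2), ts.MRup GN k j
      + ((∑ j ∈ range (ts.task k).m, (ts.task k).CLup j
          + ∑ i ∈ ts.hp k, (ts.task i).CWmax (GN i) r : ℝ) : EReal)

/-- The bound `R_k` on the end-to-end response time of task `k` when each task `i` has `2 GN i`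
dedicated virtual SMs. -/
def Rup (k : Fin n) : EReal := min (ts.R1up GN k) (ts.R2up GN k)

end TaskSet

/-! ### Executions of a task set -/

/-- `(i, q, p)` is the segment at position `p` of the `q`-th job of task `i`.  The positions
`0, 1, …, 4 (m - 1)` run through `C⁰ M⁰ G⁰ M¹ C¹ M² G¹ M³ … C^(m-1)`, so the position `p` is
the CPU segment `p / 4` if `p % 4 = 0`, the memory copy `2 (p / 4)` if `p % 4 = 1`, the GPU segment
`p / 4` if `p % 4 = 2`, and the memory copy `2 (p / 4) + 1` if `p % 4 = 3`. -/
abbrev Seg (n : ℕ) := Fin n × ℕ × ℕ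

/-- A run of the system: release times of the jobs (`⊤` for jobs that are never released), the
actual demands of each segment, and what the CPU and the bus execute at each time. -/
structure Run (n : ℕ) where
  release : Fin n → ℕ → EReal
  /-- execution time of the CPU segment `j` of the job `q` of the task `i` -/
  cpuTime : Fin n → ℕ → ℕ → ℝ
  /-- execution time of the memory-copy segment `j` -/
  copyTime : Fin n → ℕ → ℕ → ℝ
  gpuWork : Fin n → ℕ → ℕ → ℝ
  gpuOverhead : Fin n → ℕ → ℕ → ℝ
  gpuRatio : Fin n → ℕ → ℕ → ℝ
  cpu : ℝ → Option (Seg n)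
  bus : ℝ → Option (Seg n)

/-- The time at which the segment `s`, available from time `a` on, has received the service `e` on
the resource `res`; it is `⊤` if this never happens. -/
def serviceEnd {n : ℕ} (res : ℝ → Option (Seg n)) (s : Seg n) (a : EReal) (e : ℝ) : EReal :=
  sInf {x : EReal | a ≤ x ∧ ∃ t : ℝ, x = t ∧
    ENNReal.ofReal e ≤ volume {u : ℝ | u < t ∧ res u = some s}}

namespace Run

variable {n : ℕ} (σ : Run n) (ts : TaskSet n) (GN : Fin n → ℕ)

/-- Execution time of a GPU segment on the `2 GN i` virtual SMs dedicated to task `i`: after the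
critical-path overhead is deducted, the inflated work is spread evenly over the virtual SMs. -/
def gpuTime (i : Fin n) (q j : ℕ) : ℝ :=
  (σ.gpuWork i q j * σ.gpuRatio i q j - σ.gpuOverhead i q j) / (2 * GN i) + σ.gpuOverhead i q j

/-- Completion time of the segment at position `p`, if it is available from time `a` on.  GPU
segments start at once, on dedicated virtual SMs. -/
def segEnd (i : Fin n) (q p : ℕ) (a : EReal) : EReal :=
  if p % 4 = 0 then serviceEnd σ.cpu (i, q, p) a (σ.cpuTime i q (p / 4))
  else if p % 4 = 1 then serviceEnd σ.bus (i, q, p) a (σ.copyTime i q (2 * (p / 4)))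
  else if p % 4 = 2 then a + (σ.gpuTime GN i q (p / 4) : ℝ)
  else serviceEnd σ.bus (i, q, p) a (σ.copyTime i q (2 * (p / 4) + 1))

/-- The time from which position `p` is available, if position `0` is available from `a` on. -/
def availFrom (i : Fin n) (q : ℕ) (a : EReal) : ℕ → EReal
  | 0 => a
  | p + 1 => σ.segEnd GN i q p (availFrom i q a p)

/-- The time from which the job `q` can start: it is released and the previous segments of the
task, including those of its previous job, are completed. -/
def jobStart (i : Fin n) : ℕ → EReal
  | 0 => σ.release i 0
  | q + 1 => max (σ.release i (q + 1))
      (σ.availFrom GN i q (jobStart i q) (4 * ((ts.task i).m - 1) + 1))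

/-- The time from which a segment is available. -/
def avail (s : Seg n) : EReal :=
  σ.availFrom GN s.1 s.2.1 (σ.jobStart ts GN s.1 s.2.1) s.2.2

/-- The time at which a segment is completed, which makes the next position available. -/
def finish (s : Seg n) : EReal := σ.avail ts GN (s.1, s.2.1, s.2.2 + 1)

/-- The segment `s` is available and not yet completed at time `u`. -/
def Pending (s : Seg n) (u : ℝ) : Prop :=
  s.2.2 ≤ 4 * ((ts.task s.1).m - 1) ∧ σ.avail ts GN s ≤ (u : EReal) ∧ (u : EReal) < σ.finish ts GN s

/-- The time at which the last segment of the job `q` of the task `i` is completed. -/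
def jobFinish (i : Fin n) (q : ℕ) : EReal := σ.finish ts GN (i, q, 4 * ((ts.task i).m - 1))

/-- The run is a possible execution of the task set under federated scheduling of the GPU segments
with allocation `GN`, preemptive fixed-priority scheduling on the CPU and non-preemptive
fixed-priority scheduling on the bus. -/
structure Legal : Prop where
  release_nonneg : ∀ i, 0 ≤ σ.release i 0
  sporadic : ∀ i q, σ.release i q + ((ts.task i).T : EReal) ≤ σ.release i (q + 1)
  cpuTime_mem : ∀ i q, ∀ j < (ts.task i).m,
    σ.cpuTime i q j ∈ Set.Icc ((ts.task i).CLlo j) ((ts.task i).CLup j)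
  copyTime_mem : ∀ i q, ∀ j < 2 * (ts.task i).m - 2,
    σ.copyTime i q j ∈ Set.Icc ((ts.task i).MLlo j) ((ts.task i).MLup j)
  gpuWork_mem : ∀ i q, ∀ j < (ts.task i).m - 1,
    σ.gpuWork i q j ∈ Set.Icc ((ts.task i).GWlo j) ((ts.task i).GWup j)
  gpuOverhead_mem : ∀ i q, ∀ j < (ts.task i).m - 1,
    σ.gpuOverhead i q j ∈ Set.Icc 0 ((ts.task i).GLup j)
  gpuRatio_mem : ∀ i q, ∀ j < (ts.task i).m - 1,
    σ.gpuRatio i q j ∈ Set.Icc 1 ((ts.task i).α j)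
  cpu_measurable : ∀ s, MeasurableSet {u : ℝ | σ.cpu u = some s}
  bus_measurable : ∀ s, MeasurableSet {u : ℝ | σ.bus u = some s}
  /-- The CPU executes only pending CPU segments. -/
  cpu_pending : ∀ u s, σ.cpu u = some s → s.2.2 % 4 = 0 ∧ σ.Pending ts GN s u
  /-- While a CPU segment is pending, the CPU executes it or a segment of higher priority. -/
  cpu_priority : ∀ u s, s.2.2 % 4 = 0 → σ.Pending ts GN s u →
    ∃ s', σ.cpu u = some s' ∧ (s' = s ∨ ts.prio s'.1 < ts.prio s.1)
  /-- The bus executes only pending memory-copy segments. -/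
  bus_pending : ∀ u s, σ.bus u = some s → s.2.2 % 2 = 1 ∧ σ.Pending ts GN s u
  /-- The bus is not idle while a memory-copy segment is pending. -/
  bus_busy : ∀ u s, s.2.2 % 2 = 1 → σ.Pending ts GN s u → ∃ s', σ.bus u = some s'
  /-- A memory copy that has started is not preempted. -/
  bus_nonpreemptive : ∀ u v s, σ.bus u = some s → u ≤ v → σ.Pending ts GN s v →
    σ.bus v = some s
  /-- A memory copy is not started while one of higher priority is pending: if `s'` is executed
  while a higher-priority `s` is pending, then `s'` had started before `s` became available. -/
  bus_priority : ∀ u s s', s.2.2 % 2 = 1 → σ.Pending ts GN s u → σ.bus u = some s' →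
    ts.prio s.1 < ts.prio s'.1 → ∃ v : ℝ, (v : EReal) < σ.avail ts GN s ∧ σ.bus v = some s'

end Run

namespace TaskSet

variable {n : ℕ} (ts : TaskSet n)

/-- Task `k` is schedulable with the allocation `GN`: in every possible execution, every job of the
task is completed by its deadline. -/
def Schedulable (GN : Fin n → ℕ) (k : Fin n) : Prop :=
  ∀ σ : Run n, σ.Legal ts GN → ∀ q : ℕ,
    σ.jobFinish ts GN k q ≤ σ.release k q + ((ts.task k).D : EReal)

/-- The allocations of the grid search on a GPU with `N` physical SMs (`2 N` virtual SMs): the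
task `i` gets `GN i ∈ {1, …, N - ∑_{j<i} GN j}` physical SMs, that is, `2 GN i` virtual SMs. -/
def grid (n N : ℕ) : Set (Fin n → ℕ) :=
  {GN | ∀ i, 1 ≤ GN i ∧ (∑ j ∈ univ.filter (· < i), GN j) + GN i ≤ N}

/-- The test applied by the grid search to an allocation. -/
def Passes (GN : Fin n → ℕ) : Prop := ∀ k, ts.Rup GN k ≤ ((ts.task k).D : EReal)

end TaskSet

end RTGPU

end

/-! The argument is a worst-case window analysis. Fix a legal run and suppose that the tasks of
higher priority than `k` meet their deadlines. The time such a task occupies the CPU or the bus in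
any window of length `t` is at most the maximum over `h` of its workload function. Indeed, if the
window touches the segments `h, …, K`, the work is at most the sum of their lengths, and also at
most `t` minus the gaps between them. These two inequalities alone imply the workload bound
(`le_workload`).

The delicate point is the gap after the last segment of a job. For the first job in the window only
the deadline helps and gives `T - D`. For later jobs the gap is defined so that lengths and gaps of
a job add up to `T`, and a single actual gap may be shorter. Only the accumulated idle time is
bounded (`work_bounds`): two consecutive releases are at least `T` apart, and at most the total
length of one job is executed between them.

The workload function is monotone in the way needed only if the gaps are nonnegative. This is no
assumption of the model. It follows from schedulability of the interfering task, applied to a run in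
which a single job of that task is alone in the system (`demand_le_of_schedulable`).

For the response times, let `r` be any solution of a fixed-point equation. If the segment were
unfinished `r` after it became available, the window of length `r` would split into interference,
bounded by the workload, and remaining time, strictly less than the constant part (demand plus
blocking). Then `r < r`. Hence the bound holds at every solution and so at their infimum, without
continuity or attainment. The bound `R1up` adds such estimates over the segments; `R2up` makes the
same argument once for the window of the whole job, charging CPU interference only once.

Both bounds are measured from the start of a job. Since `D ≤ T`, a job that meets its deadline is
finished before the next release, so by induction every job starts at its release. The second
statement follows by induction on the priority. -/

noncomputable section

namespace RTGPU

/-! ### The workload function -/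

/-- Compare `K` with the number `N` of segment-gap pairs that fit into `t`. For `K < N` the length
bound suffices. For `K > N` the gap after segment `h + N` lies before segment `h + K`, and since one
more pair would exceed `t`, the idle-time bound already forces `V` below the lengths up to `h + N`.
-/
theorem le_workload {L S : ℕ → ℝ} {h K : ℕ} {t V : ℝ} (hL : ∀ j, 0 ≤ L j) (hS : ∀ j, 0 ≤ S j)
    (ht : 0 ≤ t) (hub : ∃ N, t < ∑ j ∈ Ico h (h + N), (L j + S j))
    (h1 : V ≤ ∑ j ∈ Ico h (h + K + 1), L j) (h2 : V ≤ t - ∑ j ∈ Ico h (h + K), S j) :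
    V ≤ Task.workload L S h t := by
  have hmono : ∀ f : ℕ → ℝ, (∀ j, 0 ≤ f j) → ∀ a b, a ≤ b →
      ∑ j ∈ Ico h (h + a), f j ≤ ∑ j ∈ Ico h (h + b), f j := fun f hf a b hab =>
    sum_le_sum_of_subset_of_nonneg (Ico_subset_Ico le_rfl (by omega)) fun _ _ _ => hf _
  have hLS : ∀ j, 0 ≤ L j + S j := fun j => add_nonneg (hL j) (hS j)
  set A : Set ℕ := {N : ℕ | ∑ j ∈ Ico h (h + N), (L j + S j) ≤ t} with hA
  obtain ⟨B, hB⟩ := hub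
  -- Without boundedness the supremum in `ℕ` would take the default value `0` and would not be a
  -- maximum.
  have hbdd : BddAbove A := ⟨B, fun N hN => by
    by_contra hlt
    exact absurd (hB.trans_le (hmono _ hLS _ _ (not_le.mp hlt).le)) (not_lt.mpr hN)⟩
  have hmem : sSup A ∈ A := Nat.sSup_mem ⟨0, by simpa [hA] using ht⟩ hbdd
  have hnot : sSup A + 1 ∉ A := fun hc => absurd (le_csSup hbdd hc) (by omega)
  change V ≤ ∑ j ∈ Ico h (h + sSup A), L j
    + min (L (h + sSup A)) (t - ∑ j ∈ Ico h (h + sSup A), (L j + S j))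
  set N := sSup A
  simp only [hA, Set.mem_ofPred_eq, not_le] at hmem hnot
  have succ : ∀ f : ℕ → ℝ, ∀ n, ∑ j ∈ Ico h (h + (n + 1)), f j
      = ∑ j ∈ Ico h (h + n), f j + f (h + n) := fun f n =>
    sum_Ico_succ_top (Nat.le_add_right h n) f
  rw [add_assoc] at h1
  rcases lt_trichotomy K N with hlt | rfl | hgt
  · have := hmono L hL (K + 1) N hlt
    have h0 : 0 ≤ min (L (h + N)) (t - ∑ j ∈ Ico h (h + N), (L j + S j)) :=
      le_min (hL _) (by linarith)
    linarith
  · rw [← min_add_add_left]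
    rw [succ] at h1
    refine le_min h1 ?_
    rw [sum_add_distrib]; linarith
  · rw [← min_add_add_left]
    have a1 := hmono S hS (N + 1) K hgt
    have a2 := hmono S hS N (N + 1) (by omega)
    rw [sum_add_distrib] at hnot ⊢
    rw [succ L N] at hnot
    exact le_min (by linarith) (by linarith)

/-- In a sequence of segments of a task, of lengths `L`, with gaps `S` after them, the work in a
window that contains (parts of) the segments `h, …, K` is bounded by the sum of their lengths, and
the idle time by the sum of the gaps between them.  The time `ρ q` is a lower bound on the start of
the segment `q * M`, the first one of the `q`-th job. -/
theorem work_bounds {X : Set ℝ} (hX : MeasurableSet X) {M h K : ℕ} (hh : h < M) (hK : h ≤ K)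
    {s e ρ L S : ℕ → ℝ} {a b T : ℝ} (hb : s (K + 1) = b) (hab : a ≤ b)
    (hinit : volume.real (X ∩ Set.Ico a (s h)) = 0)
    (hw : ∀ j, h ≤ j → j ≤ K → volume.real (X ∩ Set.Ico (s j) (s (j + 1))) ≤ L j)
    (hidle : ∀ j, h ≤ j → j < K → volume.real (X ∩ Set.Ico (e j) (s (j + 1))) = 0)
    (hse : ∀ j, h ≤ j → j < K → s j ≤ e j)
    (hes : ∀ j, h ≤ j → j < K → e j ≤ s (j + 1))
    (hsK : s K ≤ b)
    (hae : h < K → a ≤ e h)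
    (hgap : ∀ j, h ≤ j → j < K → j % M ≠ M - 1 → e j + S j ≤ s (j + 1))
    (hlast : ∀ q, (q + 1) * M ≤ K → e (q * M + (M - 1)) + S (M - 1) ≤ ρ (q + 1))
    (hS : 0 ≤ S (M - 1))
    (hρs : ∀ q, (q + 1) * M ≤ K → ρ (q + 1) ≤ s ((q + 1) * M))
    (hρ : ∀ q, (q + 2) * M ≤ K → ρ (q + 1) + T ≤ ρ (q + 2))
    (hcyc : ∀ q, ∑ j ∈ Ico ((q + 1) * M) ((q + 2) * M), (L j + S j) = T) :
    volume.real (X ∩ Set.Ico a b) ≤ ∑ j ∈ Ico h (K + 1), L j ∧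
    volume.real (X ∩ Set.Ico a b) ≤ b - a - ∑ j ∈ Ico h K, S j := by
  -- `ω u` is the work and `ι u` the idle time in the window up to `u`. Their sum is the elapsed
  -- time, so upper bounds on work turn into lower bounds on idle time.
  set ω : ℝ → ℝ := fun u => volume.real (X ∩ Set.Ico a u) with hω
  set ι : ℝ → ℝ := fun u => volume.real (Set.Ico a u \ X) with hι
  have fin : ∀ x y : ℝ, volume (Set.Ico x y) ≠ ⊤ := fun x y => by simp
  have finX : ∀ x y : ℝ, volume (X ∩ Set.Ico x y) ≠ ⊤ := fun x y =>
    ne_top_of_le_ne_top (fin x y) (measure_mono Set.inter_subset_right)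
  have ιmono : ∀ x y, x ≤ y → ι x ≤ ι y := fun x y hxy =>
    measureReal_mono (Set.sdiff_subset_sdiff_left (Set.Ico_subset_Ico_right hxy))
      (ne_top_of_le_ne_top (fin a y) (measure_mono Set.sdiff_subset))
  have split : ∀ x, a ≤ x → ω x + ι x = x - a := fun x hx => by
    have := measureReal_inter_add_sdiff (μ := volume) (s := Set.Ico a x) hX (fin a x)
    rw [Real.volume_real_Ico_of_le hx, Set.inter_comm] at this
    exact this
  have ωadd : ∀ x y, ω y ≤ ω x + volume.real (X ∩ Set.Ico x y) := fun x y => by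
    refine (measureReal_mono ?_ (measure_union_ne_top (finX _ _) (finX _ _))).trans
      (measureReal_union_le _ _)
    rintro u ⟨hu, h1, h2⟩
    rcases lt_or_ge u x with h | h
    · exact Or.inl ⟨hu, h1, h⟩
    · exact Or.inr ⟨hu, h, h2⟩
  have ωz : ∀ x y, a ≤ x → x ≤ y → volume.real (X ∩ Set.Ico x y) = 0 → ι x + (y - x) ≤ ι y :=
    fun x y hax hxy h0 => by
      have := ωadd x y
      have := split x hax
      have := split y (hax.trans hxy)
      linarith
  have ssucc : ∀ j, h ≤ j → j ≤ K → s j ≤ s (j + 1) := fun j h1 h2 => by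
    rcases h2.lt_or_eq with h2 | rfl
    · exact (hse j h1 h2).trans (hes j h1 h2)
    · rw [hb]; exact hsK
  have hωs : ∀ j i, h ≤ i → i + j ≤ K + 1 → ω (s (i + j)) ≤ ω (s i) + ∑ l ∈ Ico i (i + j), L l := by
    intro j
    induction j with
    | zero => intro i _ _; simp
    | succ j ih =>
      intro i hi hj
      have h1 := ih i hi (by omega)
      have h2 := ωadd (s (i + j)) (s (i + j + 1))
      have h3 := hw (i + j) (by omega) (by omega)
      rw [← add_assoc, sum_Ico_succ_top (by omega)]
      linarith
  have hω0 : ω (s h) = 0 := hinit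
  have ae : ∀ j, h ≤ j → j < K → a ≤ e j := by
    intro j hj
    induction j, hj using Nat.le_induction with
    | base => exact hae
    | succ j hj ih =>
      intro hjK
      exact ((ih (by omega)).trans (hes j hj (by omega))).trans (hse (j + 1) (by omega) hjK)
  have ιgap : ∀ j x, h ≤ j → j < K → e j ≤ x → x ≤ s (j + 1) →
      ι (s j) + (x - e j) ≤ ι x := fun j x h1 h2 h3 h4 => by
    refine (add_le_add_left (ιmono _ _ (hse j h1 h2)) _).trans (ωz _ _ (ae j h1 h2) h3 ?_)
    refine le_antisymm ?_ measureReal_nonneg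
    rw [← hidle j h1 h2]
    exact measureReal_mono (Set.inter_subset_inter_right _ (Set.Ico_subset_Ico_right h4))
      (finX _ _)
  -- a bound at the start of a part of a job propagates inside the job
  have inner : ∀ r i, h ≤ i → i + r ≤ K → i % M + r < M →
      ι (s i) + ∑ l ∈ Ico i (i + r), S l ≤ ι (s (i + r)) := by
    intro r
    induction r with
    | zero => intro i _ _ _; simp
    | succ r ih =>
      intro i hi hiK hr
      have h1 := ih i hi (by omega) (by omega)
      have hmod : (i + r) % M ≠ M - 1 := by
        rw [Nat.add_mod, Nat.mod_eq_of_lt (a := r) (by omega), Nat.mod_eq_of_lt (by omega)]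
        omega
      have h2 := hgap (i + r) (by omega) (by omega) hmod
      have h3 := ιgap (i + r) (s (i + r + 1)) (by omega) (by omega)
        (hes _ (by omega) (by omega)) le_rfl
      rw [← add_assoc, sum_Ico_succ_top (by omega)]
      linarith
  have ι0 : ∀ x, 0 ≤ ι x := fun x => measureReal_nonneg
  -- Idle time accumulated up to the earliest start of each job. The base case uses the inner gaps
  -- of the first, possibly incomplete, job and the deadline slack `S (M - 1)`. In the induction
  -- step, at least `T` elapses between consecutive values of `ρ`, of which at most the lengths of
  -- one cycle are work; by `hcyc` the rest is the sum of the gaps of that cycle.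
  have jobs : ∀ q, (q + 1) * M ≤ K → ∑ l ∈ Ico h ((q + 1) * M), S l ≤ ι (ρ (q + 1)) := by
    intro q
    induction q with
    | zero =>
      intro hq
      simp only [zero_add, one_mul] at hq ⊢
      have h1 := inner (M - 1 - h) h le_rfl (by omega) (by rw [Nat.mod_eq_of_lt hh]; omega)
      rw [show h + (M - 1 - h) = M - 1 by omega] at h1
      have h2 := hlast 0 (by simpa using hq)
      have h3 := hρs 0 (by simpa using hq)
      simp only [zero_add, zero_mul, one_mul] at h2 h3
      have h4 := ιgap (M - 1) (ρ 1) (by omega) (by omega) (by linarith)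
        (by rwa [Nat.sub_add_cancel (by omega)])
      have h5 := ι0 (s h)
      rw [show M = M - 1 + 1 by omega, sum_Ico_succ_top (by omega)]
      linarith
    | succ q ih =>
      intro hq
      have hqM : (q + 1 + 1) * M = (q + 1) * M + M := by ring
      have hge : M ≤ (q + 1) * M := Nat.le_mul_of_pos_left _ (by omega)
      have h1 := ih (by omega)
      have h2 := hcyc q
      rw [sum_add_distrib] at h2
      have h3 := hρ q hq
      have h4 := hωs M ((q + 1) * M) (by omega) (by omega)
      rw [← hqM] at h4
      have h5 := hρs (q + 1) hq
      have h6 := hlast q (by omega)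
      have hqm : q * M + (M - 1) + 1 = (q + 1) * M := by
        have : (q + 1) * M = q * M + M := by ring
        omega
      have h7 := hρs q (by omega)
      have hid := hidle (q * M + (M - 1)) (by omega) (by omega)
      have haρ : a ≤ ρ (q + 1) := by
        have := ae (q * M + (M - 1)) (by omega) (by omega)
        linarith
      -- Nothing is executed between `ρ (q + 1)` and the actual start of that job, so a delayed
      -- start does not add work to the cycle.
      have hω1 : ω (s ((q + 1) * M)) ≤ ω (ρ (q + 1)) := by
        have h8 : volume.real (X ∩ Set.Ico (ρ (q + 1)) (s ((q + 1) * M))) ≤ 0 := by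
          rw [← hid, hqm]
          exact measureReal_mono
            (Set.inter_subset_inter_right _ (Set.Ico_subset_Ico_left (by linarith))) (finX _ _)
        have := ωadd (ρ (q + 1)) (s ((q + 1) * M))
        linarith
      have hω2 : ω (ρ (q + 1 + 1)) ≤ ω (s ((q + 1 + 1) * M)) :=
        measureReal_mono (Set.inter_subset_inter_right _ (Set.Ico_subset_Ico_right h5))
          (finX _ _)
      have hT : ρ (q + 1) ≤ ρ (q + 1 + 1) := by
        have := hes ((q + 1) * M + (M - 1)) (by omega) (by omega)
        have h8 := hlast (q + 1) hq
        have h9 : s ((q + 1) * M) ≤ e ((q + 1) * M + (M - 1)) := by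
          refine le_trans ?_ (hse _ (by omega) (by omega))
          have : ∀ r, r ≤ M - 1 → s ((q + 1) * M) ≤ s ((q + 1) * M + r) := by
            intro r
            induction r with
            | zero => intro _; simp
            | succ r ih => exact fun hr => (ih (by omega)).trans (ssucc _ (by omega) (by omega))
          exact this _ le_rfl
        linarith
      have h8 := split _ haρ
      have h9 := split _ (haρ.trans hT)
      rw [← sum_Ico_consecutive S (m := h) (n := (q + 1) * M) (by omega) (by omega)]
      change _ + ∑ l ∈ Ico ((q + 1) * M) ((q + 2) * M), S l ≤ _
      change _ ≤ _ + ∑ l ∈ Ico ((q + 1) * M) ((q + 2) * M), L l at h4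
      change ρ (q + 1) + T ≤ ρ (q + 1 + 1) at h3
      linarith
  -- Either the window stays within its first job, or `jobs` covers everything up to the last job
  -- begun and `inner` covers the rest.
  have idle : ∑ l ∈ Ico h K, S l ≤ ι (s K) := by
    rcases lt_or_ge K M with hlt | hge
    · have h1 := inner (K - h) h le_rfl (by omega) (by rw [Nat.mod_eq_of_lt hh]; omega)
      rw [show h + (K - h) = K by omega] at h1
      linarith [ι0 (s h)]
    · obtain ⟨q, hq⟩ : ∃ q, K / M = q + 1 :=
        Nat.exists_eq_succ_of_ne_zero (Nat.div_pos hge (by omega)).ne'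
      have hdm := Nat.div_add_mod' K M
      rw [hq] at hdm
      have hmod := Nat.mod_lt K (show 0 < M by omega)
      have hge : M ≤ (q + 1) * M := Nat.le_mul_of_pos_left _ (by omega)
      have h1 := jobs q (by omega)
      have h2 := inner (K % M) ((q + 1) * M) (by omega) (by omega) (by
        rw [Nat.mul_mod_left]; omega)
      rw [hdm] at h2
      have h3 := ιmono _ _ (hρs q (by omega))
      rw [← sum_Ico_consecutive S (m := h) (n := (q + 1) * M) (by omega) (by omega)]
      linarith
  constructor
  · have := hωs (K + 1 - h) h le_rfl (by omega)
    rw [show h + (K + 1 - h) = K + 1 by omega, hb] at this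
    change ω b ≤ _
    linarith
  · have h1 := split b hab
    have h2 := ιmono _ _ hsK
    change ω b ≤ _
    linarith

/-- Every complete cycle contributes `T > 0`. This makes the set defining the workload function
bounded. -/
theorem exists_lt_sum_of_cycle {L S : ℕ → ℝ} {M h : ℕ} (hh : h < M) {T : ℝ} (hT : 0 < T)
    (hL : ∀ j, 0 ≤ L j) (hS : ∀ j, 0 ≤ S j)
    (hcyc : ∀ q, ∑ j ∈ Ico ((q + 1) * M) ((q + 2) * M), (L j + S j) = T) (t : ℝ) :
    ∃ N, t < ∑ j ∈ Ico h (h + N), (L j + S j) := by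
  obtain ⟨Q, hQ⟩ := exists_nat_gt (t / T)
  rw [div_lt_iff₀ hT] at hQ
  -- With this length the sum ends at index `(Q + 1) * M`, so it contains `Q` full cycles after the
  -- remainder of the first job.
  refine ⟨(Q + 1) * M - h, hQ.trans_le ?_⟩
  have hM : M ≤ (Q + 1) * M := Nat.le_mul_of_pos_left _ (by omega)
  have key : ∀ Q : ℕ, ∑ j ∈ Ico M ((Q + 1) * M), (L j + S j) = Q * T := by
    intro Q
    induction Q with
    | zero => simp
    | succ Q ih =>
      have hge : M ≤ (Q + 1) * M := Nat.le_mul_of_pos_left _ (by omega)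
      rw [← sum_Ico_consecutive _ hge (Nat.mul_le_mul_right M (by omega)), ih, hcyc]
      push_cast; ring
  rw [← key, show h + ((Q + 1) * M - h) = (Q + 1) * M by omega]
  exact sum_le_sum_of_subset_of_nonneg (Ico_subset_Ico hh.le le_rfl)
    fun _ _ _ => add_nonneg (hL _) (hS _)

/-- The work of a task in a window of length `t` is bounded by the workload function. -/
theorem work_le_iSup_workload {X : Set ℝ} (hX : MeasurableSet X) {M : ℕ} (hM : 0 < M)
    {s e ρ : ℕ → EReal} {L S : ℕ → ℝ} {T : ℝ} (hT : 0 < T)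
    (hL : ∀ j, 0 ≤ L j) (hS : ∀ j, 0 ≤ S j)
    (hLper : ∀ q j, L (q * M + j) = L j)
    (hSper : ∀ q j, j % M ≠ M - 1 → S (q * M + j) = S j)
    (hcyc : ∀ q, ∑ j ∈ Ico ((q + 1) * M) ((q + 2) * M), (L j + S j) = T)
    (hXs : ∀ u ∈ X, ∃ j, s j ≤ (u : EReal) ∧ (u : EReal) < e j)
    (hw : ∀ j, volume (X ∩ {u : ℝ | s j ≤ (u : EReal) ∧ (u : EReal) < e j})
      ≤ ENNReal.ofReal (L j))
    (hse : ∀ j, s j ≤ e j) (hes : ∀ j, e j ≤ s (j + 1))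
    (hgap : ∀ j, j % M ≠ M - 1 → e j + (S j : EReal) ≤ s (j + 1))
    (hlast : ∀ q, e (q * M + (M - 1)) + (S (M - 1) : EReal) ≤ ρ (q + 1))
    (hρs : ∀ q, ρ q ≤ s (q * M)) (hρ : ∀ q, ρ q + (T : EReal) ≤ ρ (q + 1)) (hρ0 : 0 ≤ ρ 0)
    (a : ℝ) {t : ℝ} (ht : 0 ≤ t) :
    volume.real (X ∩ Set.Ico a (a + t)) ≤ ⨆ h : Fin M, Task.workload L S h t := by
  have hsup : ∀ h (hh : h < M), Task.workload L S h t ≤ ⨆ h : Fin M, Task.workload L S h t :=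
    fun h hh => le_ciSup (f := fun h : Fin M => Task.workload L S h t)
      (Set.finite_range _).bddAbove ⟨h, hh⟩
  have hub := fun h (hh : h < M) => exists_lt_sum_of_cycle hh hT hL hS hcyc t
  have hempty : (∀ u ∈ X, a ≤ u → u < a + t → False) →
      volume.real (X ∩ Set.Ico a (a + t)) ≤ ⨆ h : Fin M, Task.workload L S h t := by
    intro hne
    have : X ∩ Set.Ico a (a + t) = ∅ :=
      Set.eq_empty_of_forall_notMem fun u ⟨h1, h2, h3⟩ => hne u h1 h2 h3
    rw [this, measureReal_empty]
    refine le_trans ?_ (hsup 0 hM)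
    exact le_workload (K := 0) hL hS ht (hub 0 hM) (by simpa using hL 0) (by simpa using ht)
  have smono : Monotone s := monotone_nat_of_le_succ fun j => (hse j).trans (hes j)
  have ees : ∀ i j, i < j → e i ≤ s j := fun i j hij => (hes i).trans (smono hij)
  have ρT : ∀ q : ℕ, ((q * T : ℝ) : EReal) ≤ ρ q := by
    intro q
    induction q with
    | zero => simpa using hρ0
    | succ q ih =>
      refine le_trans ?_ (hρ q)
      rw [show ((q + 1 : ℕ) * T : ℝ) = q * T + T by push_cast; ring, EReal.coe_add]
      exact add_le_add_left ih _
  have s0 : ∀ j, 0 ≤ s j := fun j => by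
    refine le_trans ?_ (smono (Nat.zero_le j))
    simpa using hρ0.trans (hρs 0)
  by_cases hex : ∃ g, (a : EReal) < e g
  swap
  · push Not at hex
    refine hempty fun u hu h1 _ => ?_
    obtain ⟨j, _, hj⟩ := hXs u hu
    exact absurd (hj.trans_le (hex j)) (by simpa using h1)
  classical
  -- The first segment that ends after `a` is the first one that can contribute. Writing it as `q0 *
  -- M + h` and shifting by `q0` jobs makes the job in progress the first one of the gap sequence,
  -- which is the only one with the special last gap.
  set g := Nat.find hex
  have hg : (a : EReal) < e g := Nat.find_spec hex
  have hgmin : ∀ i < g, e i ≤ a := fun i hi => not_lt.mp (Nat.find_min hex hi)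
  by_cases hsg : (s g : EReal) < ((a + t : ℝ) : EReal)
  swap
  · rw [not_lt] at hsg
    refine hempty fun u hu h1 h2 => ?_
    obtain ⟨j, hj1, hj2⟩ := hXs u hu
    rcases lt_or_ge j g with h | h
    · exact absurd (hj2.trans_le (hgmin j h)) (by simpa using h1)
    · exact absurd (EReal.coe_le_coe_iff.mp ((hsg.trans (smono h)).trans hj1)) (not_le.mpr h2)
  have hbig : ∃ k, ((a + t : ℝ) : EReal) ≤ s k := by
    obtain ⟨Q, hQ⟩ := exists_nat_gt ((a + t) / T)
    rw [div_lt_iff₀ hT] at hQ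
    exact ⟨Q * M, (EReal.coe_le_coe_iff.mpr hQ.le).trans ((ρT Q).trans (hρs Q))⟩
  obtain ⟨q0, h, hh, hgq⟩ : ∃ q0 h, h < M ∧ g = q0 * M + h :=
    ⟨g / M, g % M, Nat.mod_lt _ hM, (Nat.div_add_mod' g M).symm⟩
  obtain ⟨K, hK, hKlt, hKge⟩ : ∃ K, h ≤ K ∧ s (q0 * M + K) < ((a + t : ℝ) : EReal) ∧
      ((a + t : ℝ) : EReal) ≤ s (q0 * M + K + 1) := by
    have h1 := Nat.find_spec hbig
    have h2 : g < Nat.find hbig := by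
      by_contra hc
      exact absurd (h1.trans (smono (not_lt.mp hc))) (not_le.mpr hsg)
    refine ⟨Nat.find hbig - 1 - q0 * M, by omega, ?_, ?_⟩
    · rw [show q0 * M + (Nat.find hbig - 1 - q0 * M) = Nat.find hbig - 1 by omega]
      exact not_le.mp (Nat.find_min hbig (by omega))
    · rwa [show q0 * M + (Nat.find hbig - 1 - q0 * M) + 1 = Nat.find hbig by omega]
  have sfin : ∀ j ≤ K, s (q0 * M + j) = ((s (q0 * M + j)).toReal : EReal) := fun j hj => by
    refine (EReal.coe_toReal ?_ ?_).symm
    · exact ((smono (by omega)).trans_lt hKlt).ne_top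
    · exact ((EReal.bot_lt_zero).trans_le (s0 _)).ne'
  have efin : ∀ j < K, e (q0 * M + j) = ((e (q0 * M + j)).toReal : EReal) := fun j hj => by
    refine (EReal.coe_toReal ?_ ?_).symm
    · exact ((ees _ (q0 * M + K) (by omega)).trans_lt hKlt).ne_top
    · exact ((EReal.bot_lt_zero).trans_le ((s0 _).trans (hse _))).ne'
  have qmul : ∀ q, (q0 + q) * M = q0 * M + q * M := fun q => by ring
  have ρfin : ∀ q, q * M ≤ K → ρ (q0 + q) = ((ρ (q0 + q)).toReal : EReal) := fun q hq => by
    refine (EReal.coe_toReal ?_ ?_).symm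
    · exact (((hρs (q0 + q)).trans (smono (by rw [qmul]; omega))).trans_lt hKlt).ne_top
    · refine (EReal.bot_lt_zero.trans_le (le_trans ?_ (ρT _))).ne'
      exact EReal.coe_nonneg.mpr (by positivity)
  -- Beyond the last segment `K` that starts inside the window, the start time is replaced by the
  -- end of the window, which truncates that segment.
  set s' : ℕ → ℝ := fun j => if j ≤ K then (s (q0 * M + j)).toReal else a + t with hs'
  set e' : ℕ → ℝ := fun j => (e (q0 * M + j)).toReal with he'
  set ρ' : ℕ → ℝ := fun q => (ρ (q0 + q)).toReal with hρ'
  have cs : ∀ j ≤ K, ((s' j : ℝ) : EReal) = s (q0 * M + j) := fun j hj => by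
    simp only [hs', if_pos hj]; exact (sfin j hj).symm
  have ce : ∀ j < K, ((e' j : ℝ) : EReal) = e (q0 * M + j) := fun j hj => (efin j hj).symm
  have cρ : ∀ q, q * M ≤ K → ((ρ' q : ℝ) : EReal) = ρ (q0 + q) := fun q hq => (ρfin q hq).symm
  have sK1 : s' (K + 1) = a + t := by simp [hs']
  have snext : ∀ j ≤ K, ((s' (j + 1) : ℝ) : EReal) ≤ s (q0 * M + j + 1) := fun j hj => by
    rcases hj.lt_or_eq with h1 | rfl
    · rw [cs _ h1, add_assoc]
    · rw [sK1]; exact hKge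
  have zero : ∀ {A : Set ℝ}, (∀ u ∈ A, False) → volume.real A = 0 := fun hA => by
    rw [Set.eq_empty_of_forall_notMem hA, measureReal_empty]
  have main := work_bounds hX hh hK (s := s') (e := e') (ρ := ρ') (L := L) (S := S) (a := a)
    (b := a + t) (T := T) sK1 (by linarith)
    (by
      refine zero fun u ⟨hu, h1, h2⟩ => ?_
      obtain ⟨j, hj1, hj2⟩ := hXs u hu
      rcases lt_or_ge j g with h | h
      · exact absurd (hj2.trans_le (hgmin j h)) (by simpa using h1)
      · have := (smono h).trans hj1
        rw [hgq, ← cs _ hK] at this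
        exact absurd h2 (not_lt.mpr (EReal.coe_le_coe_iff.mp this)))
    (by
      intro j hj hjK
      rw [← hLper q0 j]
      refine ENNReal.toReal_le_of_le_ofReal (hL _) ((measure_mono ?_).trans (hw (q0 * M + j)))
      rintro u ⟨hu, h1, h2⟩
      refine ⟨hu, ?_⟩
      obtain ⟨i, hi1, hi2⟩ := hXs u hu
      have h1' := EReal.coe_le_coe_iff.mpr h1
      rw [cs j hjK] at h1'
      have h2' := (EReal.coe_lt_coe_iff.mpr h2).trans_le (snext j hjK)
      rcases lt_trichotomy i (q0 * M + j) with h | rfl | h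
      · exact absurd (hi2.trans_le (ees _ _ h)) (not_lt.mpr h1')
      · exact ⟨hi1, hi2⟩
      · exact absurd (h2'.trans_le (smono h)) (not_lt.mpr hi1))
    (by
      intro j hj hjK
      refine zero fun u ⟨hu, h1, h2⟩ => ?_
      obtain ⟨i, hi1, hi2⟩ := hXs u hu
      have h1' := EReal.coe_le_coe_iff.mpr h1
      rw [ce j hjK] at h1'
      have h2' := (EReal.coe_lt_coe_iff.mpr h2).trans_le (snext j hjK.le)
      rcases lt_or_ge (q0 * M + j) i with h | h
      · exact absurd (h2'.trans_le (smono h)) (not_lt.mpr hi1)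
      · have : e i ≤ e (q0 * M + j) := by
          rcases h.lt_or_eq with h | rfl
          · exact (ees _ _ h).trans (hse _)
          · exact le_rfl
        exact absurd (hi2.trans_le (this.trans h1')) (lt_irrefl _))
    (by
      intro j _ hjK
      rw [← EReal.coe_le_coe_iff, cs j hjK.le, ce j hjK]; exact hse _)
    (by
      intro j _ hjK
      rw [← EReal.coe_le_coe_iff, cs _ hjK, ce j hjK]; exact hes _)
    (by
      rw [← EReal.coe_le_coe_iff, cs _ le_rfl]; exact hKlt.le)
    (by
      intro hhK
      rw [← EReal.coe_le_coe_iff, ce _ hhK, ← hgq]; exact hg.le)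
    (by
      intro j _ hjK hmod
      rw [← EReal.coe_le_coe_iff, EReal.coe_add, cs _ hjK, ce j hjK, ← hSper q0 j hmod]
      refine hgap _ ?_
      rwa [Nat.mul_add_mod_self_right])
    (by
      intro q hq
      have : (q + 1) * M = q * M + M := by ring
      rw [← EReal.coe_le_coe_iff, EReal.coe_add, ce _ (by omega), cρ _ hq, ← add_assoc, ← qmul,
        ← add_assoc]
      exact hlast _)
    (hS _)
    (by
      intro q hq
      rw [← EReal.coe_le_coe_iff, cs _ hq, cρ _ hq, ← qmul]
      exact hρs _)
    (by
      intro q hq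
      have : (q + 2) * M = (q + 1) * M + M := by ring
      rw [← EReal.coe_le_coe_iff, EReal.coe_add, cρ _ hq, cρ _ (by omega)]
      exact hρ _)
    hcyc
  obtain ⟨m1, m2⟩ := main
  refine (le_workload (K := K - h) hL hS ht (hub h hh) ?_ ?_).trans (hsup h hh)
  · rwa [show h + (K - h) + 1 = K + 1 by omega]
  · rw [show h + (K - h) = K by omega]; linarith

/-! ### Service on a resource -/

section Service

variable {n : ℕ} {res : ℝ → Option (Seg n)} {s : Seg n} {a : EReal} {e : ℝ}

theorem le_serviceEnd : a ≤ serviceEnd res s a e := le_sInf fun _ hx => hx.1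

theorem service_lt {c : ℝ} (hac : a ≤ c) (hc : (c : EReal) < serviceEnd res s a e) :
    volume {u : ℝ | u < c ∧ res u = some s} < ENNReal.ofReal e := by
  by_contra h
  have : serviceEnd res s a e ≤ c := sInf_le ⟨hac, c, rfl, not_lt.mp h⟩
  exact absurd this (not_le.mpr hc)

/-- Before any time short of the completion time the service is still below `e`, and by `h` nothing
is executed later. -/
theorem service_le (h : ∀ u, res u = some s → a ≤ (u : EReal) ∧ (u : EReal) < serviceEnd res s a e) :
    volume {u : ℝ | res u = some s} ≤ ENNReal.ofReal e := by
  -- Rational times below the completion time exhaust the service by a countable directed union, to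
  -- which continuity from below applies.
  let I := {c : ℚ // ((c : ℝ) : EReal) < serviceEnd res s a e}
  let A : I → Set ℝ := fun c => {u : ℝ | u < (c.1 : ℝ) ∧ res u = some s}
  have hdir : Directed (· ⊆ ·) A := by
    refine Monotone.directed_le fun c d hcd u hu => ⟨hu.1.trans_le ?_, hu.2⟩
    exact_mod_cast hcd
  have hun : {u : ℝ | res u = some s} = ⋃ c, A c := by
    ext u
    simp only [Set.mem_iUnion]
    refine ⟨fun hu => ?_, fun ⟨_, hu⟩ => hu.2⟩
    obtain ⟨x, hx1, hx2⟩ := EReal.lt_iff_exists_rat_btwn.mp (h u hu).2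
    exact ⟨⟨x, hx2⟩, EReal.coe_lt_coe_iff.mp hx1, hu⟩
  rw [hun, hdir.measure_iUnion]
  refine iSup_le fun c => ?_
  rcases le_or_gt a ((c.1 : ℝ) : EReal) with hac | hac
  · exact (service_lt hac c.2).le
  · have : A c = ∅ := by
      refine Set.eq_empty_of_forall_notMem fun u hu => ?_
      have := (h u hu.2).1.trans_lt (EReal.coe_lt_coe_iff.mpr hu.1)
      exact absurd this (not_lt.mpr hac.le)
    rw [this, measure_empty]
    exact zero_le

/-- A resource serves at most one unit of work per unit of time, and none before `a`. -/
theorem add_le_serviceEnd (h : ∀ u, res u = some s → a ≤ (u : EReal)) :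
    a + (e : EReal) ≤ serviceEnd res s a e := by
  refine le_sInf ?_
  rintro x ⟨hx, t, rfl, ht⟩
  induction a with
  | bot => simp
  | top => simp at hx
  | coe a =>
    have hat := EReal.coe_le_coe_iff.mp hx
    have h1 : volume {u : ℝ | u < t ∧ res u = some s} ≤ volume (Set.Ico a t) :=
      measure_mono fun u hu => ⟨EReal.coe_le_coe_iff.mp (h u hu.2), hu.1⟩
    rw [Real.volume_Ico] at h1
    have h2 := (ENNReal.ofReal_le_ofReal_iff (by linarith)).mp (ht.trans h1)
    rw [← EReal.coe_add, EReal.coe_le_coe_iff]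
    linarith

end Service

/-! ### Segments and jobs in a legal run -/

namespace Task

variable (τ : Task) {g : ℕ}

theorem GRlo_nonneg {j : ℕ} (hj : j < τ.m - 1) : 0 ≤ τ.GRlo g j :=
  div_nonneg (τ.GW_nonneg j hj) (by positivity)

theorem CLup_nonneg {j : ℕ} (hj : j < τ.m) : 0 ≤ τ.CLup j := (τ.CL_nonneg j hj).trans (τ.CL_le j hj)

theorem MLup_nonneg {j : ℕ} (hj : j < 2 * τ.m - 2) : 0 ≤ τ.MLup j :=
  (τ.ML_nonneg j hj).trans (τ.ML_le j hj)

theorem T_pos : 0 < τ.T := τ.D_pos.trans_le τ.D_le_T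

end Task

namespace Run

variable {n : ℕ} {σ : Run n} {ts : TaskSet n} {GN : Fin n → ℕ}

theorem finish_cpu {i : Fin n} {q p : ℕ} (hp : p % 4 = 0) :
    σ.finish ts GN (i, q, p)
      = serviceEnd σ.cpu (i, q, p) (σ.avail ts GN (i, q, p)) (σ.cpuTime i q (p / 4)) := by
  change σ.segEnd GN i q p _ = _
  rw [segEnd, if_pos hp]; rfl

theorem finish_bus {i : Fin n} {q p : ℕ} (hp : p % 2 = 1) :
    σ.finish ts GN (i, q, p)
      = serviceEnd σ.bus (i, q, p) (σ.avail ts GN (i, q, p)) (σ.copyTime i q (p / 2)) := by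
  change σ.segEnd GN i q p _ = _
  rw [segEnd, if_neg (by omega)]
  split_ifs with h1 h2
  · rw [show 2 * (p / 4) = p / 2 by omega]; rfl
  · omega
  · rw [show 2 * (p / 4) + 1 = p / 2 by omega]; rfl

theorem finish_gpu {i : Fin n} {q p : ℕ} (hp : p % 4 = 2) :
    σ.finish ts GN (i, q, p) = σ.avail ts GN (i, q, p) + (σ.gpuTime GN i q (p / 4) : ℝ) := by
  change σ.segEnd GN i q p _ = _
  rw [segEnd, if_neg (by omega), if_neg (by omega), if_pos hp]; rfl

namespace Legal

variable (hσ : σ.Legal ts GN)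
include hσ

/-- The overhead enters with the coefficient `1 - 1 / (2 * GN i)`. It is nonnegative because `GN i ≥
1`, so the smallest time is attained without overhead; the upper bound uses the same coefficient. -/
theorem GRlo_le_gpuTime (hg : ∀ i, 1 ≤ GN i) {i : Fin n} {q j : ℕ} (hj : j < (ts.task i).m - 1) :
    (ts.task i).GRlo (GN i) j ≤ σ.gpuTime GN i q j := by
  obtain ⟨w1, -⟩ := hσ.gpuWork_mem i q j hj
  obtain ⟨l1, -⟩ := hσ.gpuOverhead_mem i q j hj
  obtain ⟨a1, -⟩ := hσ.gpuRatio_mem i q j hj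
  have w0 := (ts.task i).GW_nonneg j hj
  have hG : (1 : ℝ) ≤ GN i := by exact_mod_cast hg i
  have hG2 : (0 : ℝ) < 2 * GN i := by linarith
  rw [Task.GRlo, gpuTime, div_add' _ _ _ hG2.ne', div_le_div_iff_of_pos_right hG2]
  nlinarith

theorem gpuTime_le_GRup (hg : ∀ i, 1 ≤ GN i) {i : Fin n} {q j : ℕ} (hj : j < (ts.task i).m - 1) :
    σ.gpuTime GN i q j ≤ (ts.task i).GRup (GN i) j := by
  obtain ⟨w1, w2⟩ := hσ.gpuWork_mem i q j hj
  obtain ⟨l1, l2⟩ := hσ.gpuOverhead_mem i q j hj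
  obtain ⟨a1, a2⟩ := hσ.gpuRatio_mem i q j hj
  have w0 := (ts.task i).GW_nonneg j hj
  have hG : (1 : ℝ) ≤ GN i := by exact_mod_cast hg i
  have hG2 : (0 : ℝ) < 2 * GN i := by linarith
  have hwa : σ.gpuWork i q j * σ.gpuRatio i q j ≤ (ts.task i).GWup j * (ts.task i).α j :=
    mul_le_mul w2 a2 (by linarith) (by linarith)
  rw [Task.GRup, gpuTime, div_add' _ _ _ hG2.ne', div_add' _ _ _ hG2.ne',
    div_le_div_iff_of_pos_right hG2]
  nlinarith

theorem cpu_add_le_finish {i : Fin n} {q j : ℕ} (hj : j < (ts.task i).m) :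
    σ.avail ts GN (i, q, 4 * j) + ((ts.task i).CLlo j : EReal) ≤ σ.finish ts GN (i, q, 4 * j) := by
  rw [finish_cpu (by omega), Nat.mul_div_cancel_left j (by omega)]
  refine le_trans ?_ (add_le_serviceEnd fun u hu => (hσ.cpu_pending u _ hu).2.2.1)
  exact add_le_add_right (EReal.coe_le_coe_iff.mpr (hσ.cpuTime_mem i q j hj).1) _

theorem bus_add_le_finish {i : Fin n} {q j : ℕ} (hj : j < 2 * (ts.task i).m - 2) :
    σ.avail ts GN (i, q, 2 * j + 1) + ((ts.task i).MLlo j : EReal)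
      ≤ σ.finish ts GN (i, q, 2 * j + 1) := by
  rw [finish_bus (by omega), show (2 * j + 1) / 2 = j by omega]
  refine le_trans ?_ (add_le_serviceEnd fun u hu => (hσ.bus_pending u _ hu).2.2.1)
  exact add_le_add_right (EReal.coe_le_coe_iff.mpr (hσ.copyTime_mem i q j hj).1) _

theorem gpu_add_le_finish (hg : ∀ i, 1 ≤ GN i) {i : Fin n} {q j : ℕ}
    (hj : j < (ts.task i).m - 1) :
    σ.avail ts GN (i, q, 4 * j + 2) + ((ts.task i).GRlo (GN i) j : EReal)
      ≤ σ.finish ts GN (i, q, 4 * j + 2) := by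
  rw [finish_gpu (by omega), show (4 * j + 2) / 4 = j by omega]
  exact add_le_add_right (EReal.coe_le_coe_iff.mpr (hσ.GRlo_le_gpuTime hg hj)) _

theorem avail_le_finish (hg : ∀ i, 1 ≤ GN i) {i : Fin n} {q p : ℕ}
    (hp : p ≤ 4 * ((ts.task i).m - 1)) :
    σ.avail ts GN (i, q, p) ≤ σ.finish ts GN (i, q, p) := by
  rcases (by omega : p % 4 = 0 ∨ p % 2 = 1 ∨ p % 4 = 2) with h | h | h
  · rw [finish_cpu h]; exact le_serviceEnd
  · rw [finish_bus h]; exact le_serviceEnd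
  · obtain ⟨j, rfl⟩ : ∃ j, p = 4 * j + 2 := ⟨p / 4, by omega⟩
    have hj : j < (ts.task i).m - 1 := by omega
    refine le_trans ?_ (hσ.gpu_add_le_finish hg hj)
    exact le_add_of_nonneg_right (EReal.coe_nonneg.mpr ((ts.task i).GRlo_nonneg hj))

theorem avail_mono (hg : ∀ i, 1 ≤ GN i) {i : Fin n} {q p p' : ℕ} (hpp : p ≤ p')
    (hp : p' ≤ 4 * ((ts.task i).m - 1) + 1) :
    σ.avail ts GN (i, q, p) ≤ σ.avail ts GN (i, q, p') := by
  induction p', hpp using Nat.le_induction with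
  | base => exact le_rfl
  | succ k _ ih => exact (ih (by omega)).trans (hσ.avail_le_finish hg (by omega))

omit hσ in
theorem release_le_avail {i : Fin n} {q : ℕ} : σ.release i q ≤ σ.avail ts GN (i, q, 0) := by
  cases q with
  | zero => exact le_rfl
  | succ q => exact le_max_left _ _

omit hσ in
theorem jobFinish_le_avail {i : Fin n} {q : ℕ} :
    σ.jobFinish ts GN i q ≤ σ.avail ts GN (i, q + 1, 0) :=
  le_max_right _ _

theorem avail_mono_job (hg : ∀ i, 1 ≤ GN i) {i : Fin n} {q q' : ℕ} (hq : q ≤ q') :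
    σ.avail ts GN (i, q, 0) ≤ σ.avail ts GN (i, q', 0) := by
  induction q', hq using Nat.le_induction with
  | base => exact le_rfl
  | succ k _ ih =>
    exact ih.trans ((hσ.avail_mono hg (Nat.zero_le _) le_rfl).trans jobFinish_le_avail)

theorem finish_le_avail (hg : ∀ i, 1 ≤ GN i) {i : Fin n} {q q' p p' : ℕ}
    (hlt : q < q' ∨ q = q' ∧ p < p') (hp : p ≤ 4 * ((ts.task i).m - 1))
    (hp' : p' ≤ 4 * ((ts.task i).m - 1)) :
    σ.finish ts GN (i, q, p) ≤ σ.avail ts GN (i, q', p') := by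
  rcases hlt with h | ⟨rfl, h⟩
  · exact (((hσ.avail_mono hg (Nat.succ_le_succ hp) le_rfl).trans jobFinish_le_avail).trans
      (hσ.avail_mono_job hg h)).trans (hσ.avail_mono hg (Nat.zero_le _) (by omega))
  · exact hσ.avail_mono hg h (hp'.trans (Nat.le_succ _))

/-- Segments of one task are executed in sequence, across jobs too, so their pending intervals are
disjoint. -/
theorem pending_unique (hg : ∀ i, 1 ≤ GN i) {s s' : Seg n} (hs : s.1 = s'.1) {u : ℝ}
    (h : σ.Pending ts GN s u) (h' : σ.Pending ts GN s' u) : s = s' := by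
  obtain ⟨i, q, p⟩ := s
  obtain ⟨i', q', p'⟩ := s'
  obtain rfl : i = i' := hs
  obtain ⟨a1, a2, a3⟩ := h
  obtain ⟨b1, b2, b3⟩ := h'
  dsimp only at a1 b1
  by_contra hne
  rcases (by
      by_contra hc
      push Not at hc
      refine hne (Prod.ext rfl (Prod.ext ?_ ?_)) <;> dsimp only <;> omega :
      (q < q' ∨ q = q' ∧ p < p') ∨ (q' < q ∨ q' = q ∧ p' < p)) with h | h
  · exact absurd ((a3.trans_le (hσ.finish_le_avail hg h a1 b1)).trans_le b2) (lt_irrefl _)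
  · exact absurd ((b3.trans_le (hσ.finish_le_avail hg h b1 a1)).trans_le a2) (lt_irrefl _)

theorem release_nonneg' {i : Fin n} {q : ℕ} : 0 ≤ σ.release i q := by
  induction q with
  | zero => exact hσ.release_nonneg i
  | succ q ih =>
    refine le_trans ?_ (hσ.sporadic i q)
    exact add_nonneg ih (EReal.coe_nonneg.mpr (ts.task i).T_pos.le)

theorem avail_nonneg (hg : ∀ i, 1 ≤ GN i) {i : Fin n} {q p : ℕ}
    (hp : p ≤ 4 * ((ts.task i).m - 1) + 1) : 0 ≤ σ.avail ts GN (i, q, p) :=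
  (hσ.release_nonneg'.trans release_le_avail).trans (hσ.avail_mono hg (Nat.zero_le _) hp)

theorem cpu_service_le {i : Fin n} {q p : ℕ} (hp : p % 4 = 0) (hpm : p ≤ 4 * ((ts.task i).m - 1)) :
    volume {u : ℝ | σ.cpu u = some (i, q, p)} ≤ ENNReal.ofReal ((ts.task i).CLup (p / 4)) := by
  refine (service_le (a := σ.avail ts GN (i, q, p)) (e := σ.cpuTime i q (p / 4)) fun u hu => ?_).trans
    (ENNReal.ofReal_le_ofReal (hσ.cpuTime_mem i q _ ?_).2)
  · have := hσ.cpu_pending u _ hu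
    rw [← finish_cpu hp]
    exact ⟨this.2.2.1, this.2.2.2⟩
  · have := (ts.task i).one_le_m
    omega

theorem bus_service_le {i : Fin n} {q p : ℕ} (hp : p % 2 = 1) (hpm : p ≤ 4 * ((ts.task i).m - 1)) :
    volume {u : ℝ | σ.bus u = some (i, q, p)} ≤ ENNReal.ofReal ((ts.task i).MLup (p / 2)) := by
  refine (service_le (a := σ.avail ts GN (i, q, p)) (e := σ.copyTime i q (p / 2)) fun u hu => ?_).trans
    (ENNReal.ofReal_le_ofReal (hσ.copyTime_mem i q _ ?_).2)
  · have := hσ.bus_pending u _ hu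
    rw [← finish_bus hp]
    exact ⟨this.2.2.1, this.2.2.2⟩
  · omega

end Legal
end Run

/-! ### The work of a higher-priority task in a window -/

theorem sum_range_two_mul {A : Type*} [AddCommMonoid A] (f : ℕ → A) (k : ℕ) :
    ∑ j ∈ range (2 * k), f j = ∑ j ∈ range k, f (2 * j) + ∑ j ∈ range k, f (2 * j + 1) := by
  induction k with
  | zero => simp
  | succ k ih =>
    rw [show 2 * (k + 1) = 2 * k + 1 + 1 by ring, sum_range_succ, sum_range_succ, ih,
      sum_range_succ, sum_range_succ]
    abel

/-- A sum over the positions of a job is a sum over its CPU, memory-copy and GPU segments. -/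
theorem sum_range_positions {A : Type*} [AddCommMonoid A] (f : ℕ → A) (k : ℕ) :
    ∑ p ∈ range (4 * k + 1), f p = ∑ j ∈ range (k + 1), f (4 * j)
      + ∑ j ∈ range (2 * k), f (2 * j + 1) + ∑ j ∈ range k, f (4 * j + 2) := by
  rw [sum_range_succ, show 4 * k = 2 * (2 * k) by ring, sum_range_two_mul f,
    sum_range_two_mul (fun j => f (2 * j)), sum_range_succ,
    show 4 * k = 2 * (2 * k) by ring]
  simp only [← mul_assoc, mul_add]
  norm_num
  abel

theorem sum_Ico_cycle (f : ℕ → ℝ) (q M : ℕ) :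
    ∑ j ∈ Ico ((q + 1) * M) ((q + 2) * M), f j = ∑ r ∈ range M, f ((q + 1) * M + r) := by
  rw [sum_Ico_eq_sum_range, show (q + 2) * M - (q + 1) * M = M by
    rw [← Nat.sub_mul, show q + 2 - (q + 1) = 1 by omega, one_mul]]

/-! ### Sign and cycle sums of the gap sequences -/

namespace Task

variable (τ : Task) (g : ℕ)

/-- The demand of a job with largest CPU and memory-copy and smallest GPU segments. -/
def demand : ℝ :=
  ∑ j ∈ range τ.m, τ.CLup j + ∑ j ∈ range (2 * τ.m - 2), τ.MLup j
    + ∑ j ∈ range (τ.m - 1), τ.GRlo g j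

theorem sum_MLlo_eq : ∑ j ∈ range (2 * τ.m - 2), τ.MLlo j
    = ∑ j ∈ range (τ.m - 1), τ.MLlo (2 * j) + ∑ j ∈ range (τ.m - 1), τ.MLlo (2 * j + 1) := by
  rw [← sum_range_two_mul, Nat.mul_sub, mul_one]

theorem sum_MLlo_le : ∑ j ∈ range (2 * τ.m - 2), τ.MLlo j ≤ ∑ j ∈ range (2 * τ.m - 2), τ.MLup j :=
  sum_le_sum fun j hj => τ.ML_le j (mem_range.mp hj)

theorem CS_inner {j : ℕ} (h : j % τ.m ≠ τ.m - 1) : τ.CS g j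
    = τ.MLlo (2 * (j % τ.m)) + τ.GRlo g (j % τ.m) + τ.MLlo (2 * (j % τ.m) + 1) := if_pos h

theorem CS_last : τ.CS g (τ.m - 1) = τ.T - τ.D := by
  have := τ.one_le_m
  rw [CS, if_neg (by rw [Nat.mod_eq_of_lt (by omega)]; simp), if_pos rfl]

theorem CS_later {q : ℕ} : τ.CS g ((q + 1) * τ.m + (τ.m - 1))
    = τ.T - ∑ i ∈ range τ.m, τ.CLup i - ∑ i ∈ range (2 * τ.m - 2), τ.MLlo i
      - ∑ i ∈ range (τ.m - 1), τ.GRlo g i := by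
  have := τ.one_le_m
  have h2 : τ.m ≤ (q + 1) * τ.m := Nat.le_mul_of_pos_left _ (by omega)
  rw [CS, if_neg, if_neg (by omega)]
  rw [Nat.mul_add_mod_self_right, Nat.mod_eq_of_lt (by omega)]; simp

/-- Only the last gap of a later job can be negative. What is subtracted from `T` there is at most
the demand, hence at most `D ≤ T`. The same demand also controls `MS`. -/
theorem CS_nonneg (hd : τ.demand g ≤ τ.D) (j : ℕ) : 0 ≤ τ.CS g j := by
  have hm := τ.one_le_m
  have hDT := τ.D_le_T
  have hj := Nat.mod_lt j (show 0 < τ.m by omega)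
  unfold CS
  split_ifs with h1 h2
  · have a1 := τ.ML_nonneg (2 * (j % τ.m)) (by omega)
    have a2 := τ.ML_nonneg (2 * (j % τ.m) + 1) (by omega)
    have a3 := τ.GRlo_nonneg (g := g) (j := j % τ.m) (by omega)
    linarith
  · linarith
  · have := τ.sum_MLlo_le
    unfold demand at hd
    linarith

/-- The last gap of a later job is defined as the complement to `T`. The first job is excluded,
since its last gap is `T - D`. -/
theorem sum_CL_CS (q : ℕ) : ∑ j ∈ Ico ((q + 1) * τ.m) ((q + 2) * τ.m),
    (τ.CLup (j % τ.m) + τ.CS g j) = τ.T := by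
  have hm := τ.one_le_m
  rw [sum_Ico_cycle, sum_add_distrib]
  have h1 : ∑ r ∈ range τ.m, τ.CLup (((q + 1) * τ.m + r) % τ.m) = ∑ r ∈ range τ.m, τ.CLup r :=
    sum_congr rfl fun r hr => by
      rw [Nat.mul_add_mod_self_right, Nat.mod_eq_of_lt (mem_range.mp hr)]
  have h2 : ∑ r ∈ range (τ.m - 1), τ.CS g ((q + 1) * τ.m + r)
      = ∑ r ∈ range (τ.m - 1), (τ.MLlo (2 * r) + τ.GRlo g r + τ.MLlo (2 * r + 1)) :=
    sum_congr rfl fun r hr => by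
      rw [mem_range] at hr
      have : ((q + 1) * τ.m + r) % τ.m = r := by
        rw [Nat.mul_add_mod_self_right, Nat.mod_eq_of_lt (by omega)]
      rw [CS_inner _ _ (by omega), this]
  have h3 : ∑ r ∈ range τ.m, τ.CS g ((q + 1) * τ.m + r)
      = ∑ r ∈ range (τ.m - 1), τ.CS g ((q + 1) * τ.m + r)
        + τ.CS g ((q + 1) * τ.m + (τ.m - 1)) := by
    rw [← sum_range_succ, Nat.sub_add_cancel hm]
  rw [h1, h3, h2, CS_later, sum_MLlo_eq, sum_add_distrib, sum_add_distrib]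
  ring

/-- A job has an even number of memory copies, so the parity of the running index tells whether a
GPU or a CPU segment follows within the job. -/
theorem mod_two_of_mod (j : ℕ) : j % (2 * τ.m - 2) % 2 = j % 2 :=
  Nat.mod_mod_of_dvd j ⟨τ.m - 1, by omega⟩

theorem MS_even {j : ℕ} (h : j % (2 * τ.m - 2) ≠ 2 * τ.m - 3) (h2 : j % 2 = 0) :
    τ.MS g j = τ.GRlo g ((j % (2 * τ.m - 2)) / 2) := if_pos ⟨h, h2⟩

theorem MS_odd {j : ℕ} (h : j % (2 * τ.m - 2) ≠ 2 * τ.m - 3) (h2 : j % 2 = 1) :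
    τ.MS g j = τ.CLlo ((j % (2 * τ.m - 2) + 1) / 2) := by
  rw [MS, if_neg (by omega), if_pos ⟨h, h2⟩]

theorem MS_last (hm : 2 ≤ τ.m) :
    τ.MS g (2 * τ.m - 3) = τ.T - τ.D + τ.CLlo (τ.m - 1) + τ.CLlo 0 := by
  have : (2 * τ.m - 3) % (2 * τ.m - 2) = 2 * τ.m - 3 := Nat.mod_eq_of_lt (by omega)
  rw [MS, if_neg (by omega), if_neg (by omega), if_pos rfl]

theorem MS_later (hm : 2 ≤ τ.m) {q : ℕ} :
    τ.MS g ((q + 1) * (2 * τ.m - 2) + (2 * τ.m - 3))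
    = τ.T - ∑ i ∈ range (2 * τ.m - 2), τ.MLup i - ∑ i ∈ Ico 1 (τ.m - 1), τ.CLlo i
      - ∑ i ∈ range (τ.m - 1), τ.GRlo g i := by
  have h2 : 2 * τ.m - 2 ≤ (q + 1) * (2 * τ.m - 2) := Nat.le_mul_of_pos_left _ (by omega)
  have h3 : ((q + 1) * (2 * τ.m - 2) + (2 * τ.m - 3)) % (2 * τ.m - 2) = 2 * τ.m - 3 := by
    rw [Nat.mul_add_mod_self_right, Nat.mod_eq_of_lt (by omega)]
  rw [MS, if_neg (by omega), if_neg (by omega), if_neg (by omega)]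

theorem MS_nonneg (hm : 2 ≤ τ.m) (hd : τ.demand g ≤ τ.D) (j : ℕ) : 0 ≤ τ.MS g j := by
  have hDT := τ.D_le_T
  have hj := Nat.mod_lt j (show 0 < 2 * τ.m - 2 by omega)
  unfold MS
  split_ifs with h1 h2 h3
  · exact τ.GRlo_nonneg (by omega)
  · exact τ.CL_nonneg _ (by omega)
  · have a1 := τ.CL_nonneg (τ.m - 1) (by omega)
    have a2 := τ.CL_nonneg 0 (by omega)
    linarith
  · have : ∑ i ∈ Ico 1 (τ.m - 1), τ.CLlo i ≤ ∑ j ∈ range τ.m, τ.CLup j := by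
      refine (sum_le_sum fun i hi => τ.CL_le i (by rw [mem_Ico] at hi; omega)).trans ?_
      refine sum_le_sum_of_subset_of_nonneg (fun i hi => ?_)
        fun i hi _ => τ.CLup_nonneg (mem_range.mp hi)
      rw [mem_Ico] at hi
      exact mem_range.mpr (by omega)
    unfold demand at hd
    linarith

theorem sum_ML_MS (hm : 2 ≤ τ.m) (q : ℕ) :
    ∑ j ∈ Ico ((q + 1) * (2 * τ.m - 2)) ((q + 2) * (2 * τ.m - 2)),
      (τ.MLup (j % (2 * τ.m - 2)) + τ.MS g j) = τ.T := by
  rw [sum_Ico_cycle, sum_add_distrib]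
  have hmod : ∀ r < 2 * τ.m - 2, ((q + 1) * (2 * τ.m - 2) + r) % (2 * τ.m - 2) = r := fun r hr => by
    rw [Nat.mul_add_mod_self_right, Nat.mod_eq_of_lt hr]
  have hpar : ∀ r < 2 * τ.m - 2, ((q + 1) * (2 * τ.m - 2) + r) % 2 = r % 2 := fun r hr => by
    rw [← mod_two_of_mod, hmod r hr]
  have h1 : ∑ r ∈ range (2 * τ.m - 2), τ.MLup (((q + 1) * (2 * τ.m - 2) + r) % (2 * τ.m - 2))
      = ∑ r ∈ range (2 * τ.m - 2), τ.MLup r :=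
    sum_congr rfl fun r hr => by rw [hmod r (mem_range.mp hr)]
  obtain ⟨k, hk⟩ : ∃ k, τ.m = k + 2 := ⟨τ.m - 2, by omega⟩
  have h2 : ∑ r ∈ range (2 * τ.m - 2), τ.MS g ((q + 1) * (2 * τ.m - 2) + r)
      = ∑ r ∈ range (τ.m - 1), τ.GRlo g r + (∑ r ∈ Ico 1 (τ.m - 1), τ.CLlo r
        + τ.MS g ((q + 1) * (2 * τ.m - 2) + (2 * τ.m - 3))) := by
    have e1 : range (2 * τ.m - 2) = range (2 * (k + 1)) := congrArg range (by omega)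
    have e2 : 2 * τ.m - 3 = 2 * k + 1 := by omega
    rw [e1, sum_range_two_mul (fun r => τ.MS g ((q + 1) * (2 * τ.m - 2) + r)),
      sum_range_succ (fun r => τ.MS g ((q + 1) * (2 * τ.m - 2) + (2 * r + 1))), e2,
      show τ.m - 1 = k + 1 by omega, sum_Ico_eq_sum_range, show k + 1 - 1 = k by omega]
    congr 1
    · refine sum_congr rfl fun r hr => ?_
      rw [mem_range] at hr
      have := hmod (2 * r) (by omega)
      have := hpar (2 * r) (by omega)
      rw [MS_even _ _ (by omega) (by omega), hmod (2 * r) (by omega)]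
      congr 1; omega
    · congr 1
      refine sum_congr rfl fun r hr => ?_
      rw [mem_range] at hr
      have := hmod (2 * r + 1) (by omega)
      have := hpar (2 * r + 1) (by omega)
      rw [MS_odd _ _ (by omega) (by omega), hmod (2 * r + 1) (by omega)]
      congr 1; omega
  rw [h1, h2, MS_later _ _ hm]
  ring

end Task

/-! ### Workload bounds for the CPU and the bus in a legal run -/

namespace Run.Legal

variable {n : ℕ} {σ : Run n} {ts : TaskSet n} {GN : Fin n → ℕ} (hσ : σ.Legal ts GN)
include hσ

theorem measurableSet_cpu (i : Fin n) : MeasurableSet {u : ℝ | ∃ q p, σ.cpu u = some (i, q, p)} := by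
  simp only [Set.ofPred_exists]
  exact MeasurableSet.iUnion fun q => MeasurableSet.iUnion fun p => hσ.cpu_measurable _

theorem measurableSet_bus (i : Fin n) : MeasurableSet {u : ℝ | ∃ q p, σ.bus u = some (i, q, p)} := by
  simp only [Set.ofPred_exists]
  exact MeasurableSet.iUnion fun q => MeasurableSet.iUnion fun p => hσ.bus_measurable _

/-- The deadline of a job precedes the next release by at least `T - D`; this is the source of the
last gap of the first job in both gap sequences. -/
theorem add_le_release_succ {i : Fin n} {q : ℕ} {x : EReal} (y : ℝ)
    (hx : x + (y : EReal) ≤ σ.release i q + ((ts.task i).D : EReal)) :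
    x + (((ts.task i).T - (ts.task i).D + y : ℝ) : EReal) ≤ σ.release i (q + 1) := by
  refine le_trans ?_ (hσ.sporadic i q)
  have := add_le_add_left hx (((ts.task i).T - (ts.task i).D : ℝ) : EReal)
  rw [add_assoc, ← EReal.coe_add, add_assoc, ← EReal.coe_add] at this
  rwa [show (ts.task i).T - (ts.task i).D + y = y + ((ts.task i).T - (ts.task i).D) by ring,
    show (ts.task i).T = (ts.task i).D + ((ts.task i).T - (ts.task i).D) by ring,
    show (ts.task i).D + ((ts.task i).T - (ts.task i).D) - (ts.task i).D
      = (ts.task i).T - (ts.task i).D by ring]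

theorem cpu_work_le (hg : ∀ i, 1 ≤ GN i) {i : Fin n}
    (hdl : ∀ q, σ.jobFinish ts GN i q ≤ σ.release i q + ((ts.task i).D : EReal))
    (hd : (ts.task i).demand (GN i) ≤ (ts.task i).D) (a : ℝ) {t : ℝ} (ht : 0 ≤ t) :
    volume.real ({u : ℝ | ∃ q p, σ.cpu u = some (i, q, p)} ∩ Set.Ico a (a + t))
      ≤ (ts.task i).CWmax (GN i) t := by
  set τ := ts.task i with hτ
  have hτm : (ts.task i).m = τ.m := rfl
  have hm : 0 < τ.m := τ.one_le_m
  have hr : ∀ j, j % τ.m < τ.m := fun j => Nat.mod_lt j hm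
  have hdiv : ∀ q r, r < τ.m → (q * τ.m + r) / τ.m = q ∧ (q * τ.m + r) % τ.m = r := fun q r h => by
    rw [Nat.mul_add_mod_self_right, Nat.mod_eq_of_lt h, Nat.mul_comm, Nat.mul_add_div hm,
      Nat.div_eq_of_lt h]; simp
  have hsucc : ∀ j, j % τ.m ≠ τ.m - 1 → (j + 1) / τ.m = j / τ.m ∧ (j + 1) % τ.m = j % τ.m + 1 := by
    intro j hj
    have h1 := Nat.div_add_mod' j τ.m
    have h2 := hdiv (j / τ.m) (j % τ.m + 1) (by have := hr j; omega)
    rwa [← add_assoc, h1] at h2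
  have hsucc' : ∀ j, j % τ.m = τ.m - 1 → (j + 1) / τ.m = j / τ.m + 1 ∧ (j + 1) % τ.m = 0 := by
    intro j hj
    have h1 := Nat.div_add_mod' j τ.m
    have h2 := hdiv (j / τ.m + 1) 0 hm
    rwa [add_mul, one_mul, add_zero, show j / τ.m * τ.m + τ.m = j + 1 by omega] at h2
  refine work_le_iSup_workload (hσ.measurableSet_cpu i) hm
    (s := fun j => σ.avail ts GN (i, j / τ.m, 4 * (j % τ.m)))
    (e := fun j => σ.finish ts GN (i, j / τ.m, 4 * (j % τ.m)))
    (ρ := fun q => σ.release i q) (T := τ.T) τ.T_pos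
    (fun j => τ.CLup_nonneg (hr j)) (fun j => τ.CS_nonneg _ hd j)
    (fun q j => by rw [Nat.mul_add_mod_self_right])
    (fun q j hj => by
      rw [Task.CS_inner _ _ hj, Task.CS_inner _ _ (by rwa [Nat.mul_add_mod_self_right]),
        Nat.mul_add_mod_self_right])
    (τ.sum_CL_CS (GN i)) ?_ ?_ (fun j => hσ.avail_le_finish hg (by have := hr j; omega)) ?_ ?_ ?_ ?_
    (hσ.sporadic i) (hσ.release_nonneg i) a ht
  · rintro u ⟨q, p, hu⟩
    obtain ⟨h0, h1, h2, h3⟩ := hσ.cpu_pending u _ hu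
    dsimp only at h0 h1
    have h4 := hdiv q (p / 4) (by omega)
    refine ⟨q * τ.m + p / 4, ?_⟩
    rw [h4.1, h4.2, show 4 * (p / 4) = p by omega]
    exact ⟨h2, h3⟩
  · intro j
    have hj := hr j
    have h1 := hσ.cpu_service_le (i := i) (q := j / τ.m) (p := 4 * (j % τ.m)) (by omega) (by omega)
    rw [Nat.mul_div_cancel_left _ (by omega)] at h1
    refine (measure_mono ?_).trans h1
    rintro u ⟨⟨q, p, hu⟩, h2, h3⟩
    have h4 := (hσ.cpu_pending u _ hu).2
    rw [Set.mem_ofPred_eq, hu, hσ.pending_unique hg (s := (i, q, p)) rfl h4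
      (s' := (i, j / τ.m, 4 * (j % τ.m))) ⟨by dsimp only; omega, h2, h3⟩]
  · intro j
    have hj := hr j
    refine hσ.finish_le_avail hg ?_ (by omega) (by have := hr (j + 1); omega)
    by_cases h : j % τ.m = τ.m - 1
    · exact Or.inl (by rw [(hsucc' j h).1]; omega)
    · exact Or.inr (by rw [(hsucc j h).1, (hsucc j h).2]; omega)
  · intro j h
    have hj := hr j
    set r := j % τ.m with hrdef
    rw [(hsucc j h).1, (hsucc j h).2, Task.CS_inner _ _ h, ← hrdef, EReal.coe_add, EReal.coe_add,
      ← add_assoc, ← add_assoc]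
    have a1 := hσ.bus_add_le_finish (i := i) (q := j / τ.m) (j := 2 * r) (by omega)
    have a2 := hσ.gpu_add_le_finish hg (i := i) (q := j / τ.m) (j := r) (by omega)
    have a3 := hσ.bus_add_le_finish (i := i) (q := j / τ.m) (j := 2 * r + 1) (by omega)
    rw [show 2 * (2 * r) + 1 = 4 * r + 1 by ring] at a1
    rw [show 2 * (2 * r + 1) + 1 = 4 * r + 2 + 1 by ring] at a3
    exact (add_le_add_left ((add_le_add_left a1 _).trans a2) _).trans a3
  · intro q
    have h1 := hdiv q (τ.m - 1) (by omega)
    rw [h1.1, h1.2, Task.CS_last]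
    have := hσ.add_le_release_succ (i := i) (q := q)
      (x := σ.finish ts GN (i, q, 4 * (τ.m - 1))) 0 (by rw [EReal.coe_zero, add_zero]; exact hdl q)
    rwa [add_zero] at this
  · intro q
    have h1 := hdiv q 0 hm
    rw [add_zero] at h1
    rw [h1.1, h1.2]
    exact release_le_avail

theorem bus_work_le (hg : ∀ i, 1 ≤ GN i) {i : Fin n}
    (hdl : ∀ q, σ.jobFinish ts GN i q ≤ σ.release i q + ((ts.task i).D : EReal))
    (hd : (ts.task i).demand (GN i) ≤ (ts.task i).D) (a : ℝ) {t : ℝ} (ht : 0 ≤ t) :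
    volume.real ({u : ℝ | ∃ q p, σ.bus u = some (i, q, p)} ∩ Set.Ico a (a + t))
      ≤ (ts.task i).MWmax (GN i) t := by
  set τ := ts.task i with hτ
  have hτm : (ts.task i).m = τ.m := rfl
  rcases (by have := τ.one_le_m; omega : τ.m = 1 ∨ 2 ≤ τ.m) with hm1 | hm
  · have : {u : ℝ | ∃ q p, σ.bus u = some (i, q, p)} = ∅ := by
      refine Set.eq_empty_of_forall_notMem ?_
      rintro u ⟨q, p, hu⟩
      obtain ⟨h0, h1, -⟩ := hσ.bus_pending u _ hu
      dsimp only at h0 h1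
      omega
    -- A real supremum over an empty index type is `0`, as wanted for a task without memory copies.
    have : IsEmpty (Fin (2 * τ.m - 2)) := ⟨fun x => by have := x.2; omega⟩
    rw [Task.MWmax, Real.iSup_of_isEmpty]
    simp [*]
  set M := 2 * τ.m - 2 with hM
  have hM0 : 0 < M := by omega
  have hM3 : 2 * τ.m - 3 = M - 1 := by omega
  have hr : ∀ j, j % M < M := fun j => Nat.mod_lt j hM0
  have hdiv : ∀ q r, r < M → (q * M + r) / M = q ∧ (q * M + r) % M = r := fun q r h => by
    rw [Nat.mul_add_mod_self_right, Nat.mod_eq_of_lt h, Nat.mul_comm, Nat.mul_add_div hM0,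
      Nat.div_eq_of_lt h]; simp
  have hsucc : ∀ j, j % M ≠ M - 1 → (j + 1) / M = j / M ∧ (j + 1) % M = j % M + 1 := by
    intro j hj
    have h1 := Nat.div_add_mod' j M
    have h2 := hdiv (j / M) (j % M + 1) (by have := hr j; omega)
    rwa [← add_assoc, h1] at h2
  have hsucc' : ∀ j, j % M = M - 1 → (j + 1) / M = j / M + 1 ∧ (j + 1) % M = 0 := by
    intro j hj
    have h1 := Nat.div_add_mod' j M
    have h2 := hdiv (j / M + 1) 0 hM0
    rwa [add_mul, one_mul, add_zero, show j / M * M + M = j + 1 by omega] at h2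
  have hpar : ∀ j, j % M % 2 = j % 2 := τ.mod_two_of_mod
  refine work_le_iSup_workload (hσ.measurableSet_bus i) hM0
    (s := fun j => σ.avail ts GN (i, j / M, 2 * (j % M) + 1))
    (e := fun j => σ.finish ts GN (i, j / M, 2 * (j % M) + 1))
    -- The first copy of a job waits for its first CPU segment, which accounts for the summand `CLlo
    -- 0` in the last gap; `CLlo (m - 1)` comes from the CPU segment between the last copy and the
    -- deadline.
    (ρ := fun q => σ.release i q + (τ.CLlo 0 : EReal)) (T := τ.T) τ.T_pos
    (fun j => τ.MLup_nonneg (hr j)) (fun j => τ.MS_nonneg _ hm hd j)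
    (fun q j => by rw [Nat.mul_add_mod_self_right])
    (fun q j hj => ?_)
    (τ.sum_ML_MS (GN i) hm) ?_ ?_ (fun j => hσ.avail_le_finish hg (by have := hr j; omega))
    ?_ ?_ ?_ ?_ ?_ ?_ a ht
  · have h1 : (q * M + j) % M = j % M := by rw [Nat.mul_add_mod_self_right]
    have h2 : (q * M + j) % 2 = j % 2 := by rw [← hpar, h1, hpar]
    rw [← hM3] at hj
    rcases Nat.mod_two_eq_zero_or_one j with h | h
    · rw [Task.MS_even _ _ hj h, Task.MS_even _ _ (by rwa [← hM, h1]) (by omega), ← hM, h1]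
    · rw [Task.MS_odd _ _ hj h, Task.MS_odd _ _ (by rwa [← hM, h1]) (by omega), ← hM, h1]
  · rintro u ⟨q, p, hu⟩
    obtain ⟨h0, h1, h2, h3⟩ := hσ.bus_pending u _ hu
    dsimp only at h0 h1
    have h4 := hdiv q (p / 2) (by omega)
    refine ⟨q * M + p / 2, ?_⟩
    rw [h4.1, h4.2, show 2 * (p / 2) + 1 = p by omega]
    exact ⟨h2, h3⟩
  · intro j
    have hj := hr j
    have h1 := hσ.bus_service_le (i := i) (q := j / M) (p := 2 * (j % M) + 1) (by omega) (by omega)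
    rw [show (2 * (j % M) + 1) / 2 = j % M by omega] at h1
    refine (measure_mono ?_).trans h1
    rintro u ⟨⟨q, p, hu⟩, h2, h3⟩
    have h4 := (hσ.bus_pending u _ hu).2
    rw [Set.mem_ofPred_eq, hu, hσ.pending_unique hg (s := (i, q, p)) rfl h4
      (s' := (i, j / M, 2 * (j % M) + 1)) ⟨by dsimp only; omega, h2, h3⟩]
  · intro j
    have hj := hr j
    refine hσ.finish_le_avail hg ?_ (by omega) (by have := hr (j + 1); omega)
    by_cases h : j % M = M - 1
    · exact Or.inl (by rw [(hsucc' j h).1]; omega)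
    · exact Or.inr (by rw [(hsucc j h).1, (hsucc j h).2]; omega)
  · intro j h
    have hj := hr j
    have hp := hpar j
    rw [(hsucc j h).1, (hsucc j h).2]
    rcases Nat.mod_two_eq_zero_or_one j with h2 | h2
    · rw [Task.MS_even _ _ (by omega) h2, ← hM]
      obtain ⟨k, hk⟩ : ∃ k, j % M = 2 * k := ⟨j % M / 2, by omega⟩
      rw [hk, show 2 * k / 2 = k by omega]
      have := hσ.gpu_add_le_finish hg (i := i) (q := j / M) (j := k) (by omega)
      rw [show 4 * k + 2 = 2 * (2 * k) + 1 + 1 by ring] at this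
      exact this
    · rw [Task.MS_odd _ _ (by omega) h2, ← hM]
      obtain ⟨k, hk⟩ : ∃ k, j % M = 2 * k + 1 := ⟨j % M / 2, by omega⟩
      rw [hk, show (2 * k + 1 + 1) / 2 = k + 1 by omega]
      have := hσ.cpu_add_le_finish (i := i) (q := j / M) (j := k + 1) (by omega)
      rw [show 4 * (k + 1) = 2 * (2 * k + 1) + 1 + 1 by ring] at this
      exact this
  · intro q
    have h1 := hdiv q (M - 1) (by omega)
    rw [h1.1, h1.2, ← hM3, Task.MS_last _ _ hm, EReal.coe_add, ← add_assoc]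
    refine add_le_add_left (hσ.add_le_release_succ _ (le_trans ?_ (hdl q))) _
    have := hσ.cpu_add_le_finish (i := i) (q := q) (j := τ.m - 1) (by omega)
    rw [show 4 * (τ.m - 1) = 2 * (2 * τ.m - 3) + 1 + 1 by omega] at this
    refine this.trans (le_of_eq ?_)
    rw [jobFinish, ← hτ, show 4 * (τ.m - 1) = 2 * (2 * τ.m - 3) + 1 + 1 by omega]
  · intro q
    have h1 := hdiv q 0 hM0
    rw [add_zero] at h1
    rw [h1.1, h1.2]
    exact (add_le_add_left (release_le_avail (ts := ts) (GN := GN)) _).trans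
      (hσ.cpu_add_le_finish (i := i) (q := q) (j := 0) (by omega))
  · intro q
    rw [add_right_comm]
    exact add_le_add_left (hσ.sporadic i q) _
  · exact add_nonneg (hσ.release_nonneg i) (EReal.coe_nonneg.mpr (τ.CL_nonneg 0 (by omega)))

end Run.Legal

/-! ### Response times -/

theorem leastSolution_nonneg (F : ℝ → EReal) : 0 ≤ leastSolution F := by
  refine le_sInf ?_
  rintro x ⟨r, rfl, hr, -⟩
  exact EReal.coe_nonneg.mpr hr

/-- The infimum need not be attained: a bound valid at every solution passes to it. With no solution
the right side is `⊤`. -/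
theorem le_add_leastSolution {F : ℝ → EReal} {a x : EReal} (ha : 0 ≤ a)
    (h : ∀ r : ℝ, 0 ≤ r → (r : EReal) = F r → x ≤ a + r) : x ≤ a + leastSolution F := by
  induction a with
  | bot => simp at ha
  | top =>
    rw [EReal.top_add_of_ne_bot (EReal.bot_lt_zero.trans_le (leastSolution_nonneg F)).ne']
    exact le_top
  | coe a =>
    have key : x - a ≤ leastSolution F := by
      refine le_sInf ?_
      rintro y ⟨r, rfl, hr, hF⟩
      rw [EReal.sub_le_iff_le_add (by simp) (by simp), add_comm]
      exact h r hr hF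
    rwa [EReal.sub_le_iff_le_add (by simp) (by simp), add_comm] at key

namespace TaskSet

variable {n : ℕ} (ts : TaskSet n)

theorem MLup_le_blocking {k i : Fin n} (h : ts.prio k < ts.prio i) {j : ℕ}
    (hj : j < 2 * (ts.task i).m - 2) : (ts.task i).MLup j ≤ ts.blocking k := by
  refine le_trans ?_ (le_ciSup (f := fun i : {i : Fin n // ts.prio k < ts.prio i} =>
    ⨆ h : Fin (2 * (ts.task i).m - 2), (ts.task i).MLup h) (Set.finite_range _).bddAbove ⟨i, h⟩)
  exact le_ciSup (f := fun h : Fin (2 * (ts.task i).m - 2) => (ts.task i).MLup h)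
    (Set.finite_range _).bddAbove ⟨j, hj⟩

theorem blocking_nonneg (k : Fin n) : 0 ≤ ts.blocking k :=
  Real.iSup_nonneg fun i => Real.iSup_nonneg fun h => (ts.task i).MLup_nonneg h.2

/-- The times at which the resource executes a task with a higher priority than `k`. -/
def hpBusy (res : ℝ → Option (Seg n)) (k : Fin n) : Set ℝ :=
  ⋃ i ∈ ts.hp k, {u : ℝ | ∃ q p, res u = some (i, q, p)}

theorem hpBusy_le {res : ℝ → Option (Seg n)} {k : Fin n} {A : Set ℝ} {B : Fin n → ℝ}
    (h : ∀ i ∈ ts.hp k, volume.real ({u : ℝ | ∃ q p, res u = some (i, q, p)} ∩ A) ≤ B i) :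
    volume.real (ts.hpBusy res k ∩ A) ≤ ∑ i ∈ ts.hp k, B i := by
  rw [hpBusy, Set.iUnion₂_inter]
  exact (measureReal_biUnion_finset_le _ _).trans (sum_le_sum h)

theorem mem_hpBusy {res : ℝ → Option (Seg n)} {k : Fin n} {u : ℝ} {s : Seg n}
    (hu : res u = some s) (hs : ts.prio s.1 < ts.prio k) : u ∈ ts.hpBusy res k := by
  simp only [hpBusy, Set.mem_iUnion]
  exact ⟨s.1, by simpa [hp] using hs, s.2.1, s.2.2, hu⟩

end TaskSet

theorem length_le {X : Set ℝ} (hX : MeasurableSet X) {x y : ℝ} (h : x ≤ y) :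
    y - x = volume.real (X ∩ Set.Ico x y) + volume.real (Set.Ico x y \ X) := by
  rw [Set.inter_comm, measureReal_inter_add_sdiff hX (by simp), Real.volume_real_Ico_of_le h]

/-! ### Response times of single segments and the bound `R1up` -/

namespace Run.Legal

variable {n : ℕ} {σ : Run n} {ts : TaskSet n} {GN : Fin n → ℕ} (hσ : σ.Legal ts GN)
include hσ

theorem measurableSet_hpBusy_cpu (k : Fin n) : MeasurableSet (ts.hpBusy σ.cpu k) :=
  Finset.measurableSet_biUnion _ fun i _ => hσ.measurableSet_cpu i

theorem measurableSet_hpBusy_bus (k : Fin n) : MeasurableSet (ts.hpBusy σ.bus k) :=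
  Finset.measurableSet_biUnion _ fun i _ => hσ.measurableSet_bus i

/-- The time before `c` at which an unfinished CPU segment is pending, but not preempted. -/
theorem cpu_busy_lt {k : Fin n} {q p : ℕ} (hp : p % 4 = 0) (hpm : p ≤ 4 * ((ts.task k).m - 1))
    {x c : ℝ} (hx : (x : EReal) = σ.avail ts GN (k, q, p)) (hxc : x ≤ c)
    (hc : (c : EReal) < σ.finish ts GN (k, q, p)) :
    volume.real (Set.Ico x c \ ts.hpBusy σ.cpu k) < (ts.task k).CLup (p / 4) := by
  have h1 := hc
  rw [finish_cpu hp] at h1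
  have h2 := service_lt (by rw [← hx]; exact EReal.coe_le_coe_iff.mpr hxc) h1
  have hm := (ts.task k).one_le_m
  refine lt_of_lt_of_le ?_ (hσ.cpuTime_mem k q (p / 4) (by omega)).2
  have h3 : volume (Set.Ico x c \ ts.hpBusy σ.cpu k)
      < ENNReal.ofReal (σ.cpuTime k q (p / 4)) := by
    refine (measure_mono ?_).trans_lt h2
    rintro u ⟨⟨u1, u2⟩, u3⟩
    obtain ⟨s', hs', hpr⟩ := hσ.cpu_priority u (k, q, p) hp ⟨hpm,
      by rw [← hx]; exact EReal.coe_le_coe_iff.mpr u1, (EReal.coe_lt_coe_iff.mpr u2).trans hc⟩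
    rcases hpr with rfl | hpr
    · exact ⟨u2, hs'⟩
    · exact absurd (ts.mem_hpBusy hs' hpr) u3
  have h4 := ENNReal.toReal_lt_of_lt_ofReal h3
  exact h4

theorem cpu_busy_le {k : Fin n} {q p : ℕ} (hp : p % 4 = 0) (hpm : p ≤ 4 * ((ts.task k).m - 1))
    {x y : ℝ} (hx : (x : EReal) = σ.avail ts GN (k, q, p))
    (hy : (y : EReal) = σ.finish ts GN (k, q, p)) :
    volume.real (Set.Ico x y \ ts.hpBusy σ.cpu k) ≤ (ts.task k).CLup (p / 4) := by
  have hm := (ts.task k).one_le_m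
  refine ENNReal.toReal_le_of_le_ofReal ((ts.task k).CLup_nonneg (by omega))
    ((measure_mono ?_).trans (hσ.cpu_service_le (i := k) (q := q) hp hpm))
  rintro u ⟨⟨u1, u2⟩, u3⟩
  obtain ⟨s', hs', hpr⟩ := hσ.cpu_priority u (k, q, p) hp ⟨hpm,
    by rw [← hx]; exact EReal.coe_le_coe_iff.mpr u1, by rw [← hy]; exact EReal.coe_lt_coe_iff.mpr u2⟩
  rcases hpr with rfl | hpr
  · exact hs'
  · exact absurd (ts.mem_hpBusy hs' hpr) u3

/-- A pending memory copy is blocked by at most one segment of lower priority. -/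
theorem blocker_unique {s s₁ s₂ : Seg n} {u₁ u₂ : ℝ} (hs : s.2.2 % 2 = 1)
    (h₁ : σ.Pending ts GN s u₁) (h₂ : σ.Pending ts GN s u₂) (b₁ : σ.bus u₁ = some s₁)
    (b₂ : σ.bus u₂ = some s₂) (p₁ : ts.prio s.1 < ts.prio s₁.1) (p₂ : ts.prio s.1 < ts.prio s₂.1) :
    s₁ = s₂ := by
  obtain ⟨v₁, hv₁, c₁⟩ := hσ.bus_priority u₁ s s₁ hs h₁ b₁ p₁
  obtain ⟨v₂, hv₂, c₂⟩ := hσ.bus_priority u₂ s s₂ hs h₂ b₂ p₂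
  have key : ∀ {t t' : Seg n} {v v' w : ℝ}, σ.bus v = some t → σ.bus v' = some t' →
      σ.bus w = some t → v ≤ v' → v' ≤ w → t = t' := by
    intro t t' v v' w hv hv' hw h1 h2
    have e1 := (hσ.bus_pending v t hv).2
    have e2 := (hσ.bus_pending w t hw).2
    have := hσ.bus_nonpreemptive v v' t hv h1 ⟨e1.1, e1.2.1.trans (EReal.coe_le_coe_iff.mpr h1),
      (EReal.coe_le_coe_iff.mpr h2).trans_lt e2.2.2⟩
    rw [hv'] at this
    exact (Option.some_injective _ this).symm
  rcases le_total v₁ v₂ with h | h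
  · exact key c₁ c₂ b₁ h (EReal.coe_le_coe_iff.mp (hv₂.le.trans h₁.2.1))
  · exact (key c₂ c₁ b₂ h (EReal.coe_le_coe_iff.mp (hv₁.le.trans h₂.2.1))).symm

/-- Outside higher-priority work the bus serves either the segment itself, for less than its demand
since it is unfinished, or a lower-priority copy, and by `blocker_unique` only one such copy occurs.
-/
theorem bus_busy_lt (hg : ∀ i, 1 ≤ GN i) {k : Fin n} {q p : ℕ} (hp : p % 2 = 1)
    (hpm : p ≤ 4 * ((ts.task k).m - 1))
    {x c : ℝ} (hx : (x : EReal) = σ.avail ts GN (k, q, p)) (hxc : x ≤ c)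
    (hc : (c : EReal) < σ.finish ts GN (k, q, p)) :
    volume.real (Set.Ico x c \ ts.hpBusy σ.bus k) < (ts.task k).MLup (p / 2) + ts.blocking k := by
  have h1 := hc
  rw [finish_bus hp] at h1
  have h2 := service_lt (by rw [← hx]; exact EReal.coe_le_coe_iff.mpr hxc) h1
  have hpend : ∀ u, x ≤ u → u < c → σ.Pending ts GN (k, q, p) u := fun u u1 u2 =>
    ⟨hpm, by rw [← hx]; exact EReal.coe_le_coe_iff.mpr u1, (EReal.coe_lt_coe_iff.mpr u2).trans hc⟩
  set E := {u : ℝ | u < c ∧ σ.bus u = some (k, q, p)} with hE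
  set F := {u : ℝ | x ≤ u ∧ u < c ∧ ∃ s, σ.bus u = some s ∧ ts.prio k < ts.prio s.1} with hF
  have hsub : Set.Ico x c \ ts.hpBusy σ.bus k ⊆ E ∪ F := by
    rintro u ⟨⟨u1, u2⟩, u3⟩
    obtain ⟨s', hs'⟩ := hσ.bus_busy u (k, q, p) hp (hpend u u1 u2)
    rcases lt_trichotomy (ts.prio s'.1) (ts.prio k) with h | h | h
    · exact absurd (ts.mem_hpBusy hs' h) u3
    · have := hσ.pending_unique hg (s := s') (s' := (k, q, p)) (ts.prio_injective h)
        (hσ.bus_pending u s' hs').2 (hpend u u1 u2)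
      exact Or.inl ⟨u2, by rw [hs', this]⟩
    · exact Or.inr ⟨u1, u2, s', hs', h⟩
  have hFle : volume F ≤ ENNReal.ofReal (ts.blocking k) := by
    rcases F.eq_empty_or_nonempty with h | ⟨u0, v1, v2, s0, hs0, hp0⟩
    · rw [h, measure_empty]; exact zero_le
    · obtain ⟨i, q0, p0⟩ := s0
      obtain ⟨w1, w2, -⟩ := hσ.bus_pending u0 _ hs0
      refine (measure_mono fun u hu => ?_).trans ((hσ.bus_service_le (i := i) (q := q0) w1 w2).trans
        (ENNReal.ofReal_le_ofReal (ts.MLup_le_blocking hp0 ?_)))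
      · obtain ⟨u1, u2, s, hs, hps⟩ := hu
        rw [Set.mem_ofPred_eq, hs, hσ.blocker_unique hp (hpend u u1 u2) (hpend u0 v1 v2) hs hs0
          hps hp0]
      · change p0 / 2 < 2 * (ts.task i).m - 2
        dsimp only at w1 w2
        omega
  have hEr := ENNReal.toReal_lt_of_lt_ofReal h2
  have hFr := ENNReal.toReal_le_of_le_ofReal (ts.blocking_nonneg k) hFle
  have hcp := (hσ.copyTime_mem k q (p / 2) (by omega)).2
  have h3 : volume.real (Set.Ico x c \ ts.hpBusy σ.bus k) ≤ volume.real E + volume.real F :=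
    (measureReal_mono hsub (measure_union_ne_top h2.ne_top
      (hFle.trans_lt ENNReal.ofReal_lt_top).ne)).trans (measureReal_union_le _ _)
  change volume.real E < _ at hEr
  change volume.real F ≤ _ at hFr
  linarith

section Response

variable (hg : ∀ i, 1 ≤ GN i) {k : Fin n}
  (hdl : ∀ i ∈ ts.hp k, ∀ q, σ.jobFinish ts GN i q ≤ σ.release i q + ((ts.task i).D : EReal))
  (hd : ∀ i ∈ ts.hp k, (ts.task i).demand (GN i) ≤ (ts.task i).D)
include hg hdl hd

theorem hp_cpu_le (x : ℝ) {r : ℝ} (hr : 0 ≤ r) :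
    volume.real (ts.hpBusy σ.cpu k ∩ Set.Ico x (x + r))
      ≤ ∑ i ∈ ts.hp k, (ts.task i).CWmax (GN i) r :=
  ts.hpBusy_le fun i hi => hσ.cpu_work_le hg (hdl i hi) (hd i hi) x hr

theorem hp_bus_le (x : ℝ) {r : ℝ} (hr : 0 ≤ r) :
    volume.real (ts.hpBusy σ.bus k ∩ Set.Ico x (x + r))
      ≤ ∑ i ∈ ts.hp k, (ts.task i).MWmax (GN i) r :=
  ts.hpBusy_le fun i hi => hσ.bus_work_le hg (hdl i hi) (hd i hi) x hr

/-- If the segment were still unfinished after time `r`, interference and the strictly incomplete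
own service would fill a window of length `r` with less than `F r = r`. Strictness makes this work
for any solution `r`. -/
theorem finish_le_add_CRup {q j : ℕ} (hj : j < (ts.task k).m) :
    σ.finish ts GN (k, q, 4 * j) ≤ σ.avail ts GN (k, q, 4 * j) + ts.CRup GN k j := by
  have h0 := hσ.avail_nonneg hg (i := k) (q := q) (p := 4 * j) (by omega)
  refine le_add_leastSolution h0 fun r hr hF => ?_
  have hF := EReal.coe_eq_coe_iff.mp hF
  by_contra hlt
  rw [not_le] at hlt
  obtain ⟨x, hx⟩ : ∃ x : ℝ, (x : EReal) = σ.avail ts GN (k, q, 4 * j) :=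
    ⟨_, EReal.coe_toReal (fun h => by rw [h] at hlt; simp at hlt)
      (EReal.bot_lt_zero.trans_le h0).ne'⟩
  rw [← hx, ← EReal.coe_add] at hlt
  have h1 := hσ.cpu_busy_lt (by omega) (by omega) hx (by linarith) hlt
  have h2 := hσ.hp_cpu_le hg hdl hd x hr
  have h3 := length_le (hσ.measurableSet_hpBusy_cpu k) (show x ≤ x + r by linarith)
  rw [Nat.mul_div_cancel_left j (by omega)] at h1
  linarith

theorem finish_le_add_MRup {q j : ℕ} (hj : j < 2 * (ts.task k).m - 2) :
    σ.finish ts GN (k, q, 2 * j + 1) ≤ σ.avail ts GN (k, q, 2 * j + 1) + ts.MRup GN k j := by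
  have h0 := hσ.avail_nonneg hg (i := k) (q := q) (p := 2 * j + 1) (by omega)
  refine le_add_leastSolution h0 fun r hr hF => ?_
  have hF := EReal.coe_eq_coe_iff.mp hF
  by_contra hlt
  rw [not_le] at hlt
  obtain ⟨x, hx⟩ : ∃ x : ℝ, (x : EReal) = σ.avail ts GN (k, q, 2 * j + 1) :=
    ⟨_, EReal.coe_toReal (fun h => by rw [h] at hlt; simp at hlt)
      (EReal.bot_lt_zero.trans_le h0).ne'⟩
  rw [← hx, ← EReal.coe_add] at hlt
  have h1 := hσ.bus_busy_lt hg (by omega) (by omega) hx (by linarith) hlt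
  have h2 := hσ.hp_bus_le hg hdl hd x hr
  have h3 := length_le (hσ.measurableSet_hpBusy_bus k) (show x ≤ x + r by linarith)
  rw [show (2 * j + 1) / 2 = j by omega] at h1
  linarith

omit hdl hd in
theorem finish_le_add_GRup {q j : ℕ} (hj : j < (ts.task k).m - 1) :
    σ.finish ts GN (k, q, 4 * j + 2)
      ≤ σ.avail ts GN (k, q, 4 * j + 2) + ((ts.task k).GRup (GN k) j : ℝ) := by
  rw [finish_gpu (by omega), show (4 * j + 2) / 4 = j by omega]
  exact add_le_add_right (EReal.coe_le_coe_iff.mpr (hσ.gpuTime_le_GRup hg hj)) _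

theorem jobFinish_le_add_R1up (q : ℕ) :
    σ.jobFinish ts GN k q ≤ σ.avail ts GN (k, q, 0) + ts.R1up GN k := by
  have hm := (ts.task k).one_le_m
  set w : ℕ → EReal := fun p => if p % 4 = 0 then ts.CRup GN k (p / 4)
    else if p % 2 = 1 then ts.MRup GN k (p / 2) else ((ts.task k).GRup (GN k) (p / 4) : ℝ) with hw
  have step : ∀ p ≤ 4 * ((ts.task k).m - 1),
      σ.finish ts GN (k, q, p) ≤ σ.avail ts GN (k, q, p) + w p := by
    intro p hp
    simp only [hw]
    split_ifs with h1 h2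
    · have := hσ.finish_le_add_CRup hg hdl hd (q := q) (j := p / 4) (by omega)
      rwa [show 4 * (p / 4) = p by omega] at this
    · have := hσ.finish_le_add_MRup hg hdl hd (q := q) (j := p / 2) (by omega)
      rwa [show 2 * (p / 2) + 1 = p by omega] at this
    · have := hσ.finish_le_add_GRup hg (k := k) (q := q) (j := p / 4) (by omega)
      rwa [show 4 * (p / 4) + 2 = p by omega] at this
  have tot : ∀ p ≤ 4 * ((ts.task k).m - 1) + 1,
      σ.avail ts GN (k, q, p) ≤ σ.avail ts GN (k, q, 0) + ∑ p' ∈ range p, w p' := by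
    intro p
    induction p with
    | zero => intro _; simp
    | succ p ih =>
      intro hp
      rw [sum_range_succ, ← add_assoc]
      exact (step p (by omega)).trans (add_le_add_left (ih (by omega)) _)
  refine (tot _ le_rfl).trans (le_of_eq ?_)
  rw [sum_range_positions, TaskSet.R1up, Nat.sub_add_cancel hm]
  have e1 : ∀ j, w (4 * j) = ts.CRup GN k j := fun j => by
    simp only [hw]
    rw [if_pos (by omega), Nat.mul_div_cancel_left j (by omega)]
  have e2 : ∀ j, w (2 * j + 1) = ts.MRup GN k j := fun j => by
    simp only [hw]
    rw [if_neg (by omega), if_pos (by omega), show (2 * j + 1) / 2 = j by omega]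
  have e3 : ∀ j, w (4 * j + 2) = ((ts.task k).GRup (GN k) j : ℝ) := fun j => by
    simp only [hw]
    rw [if_neg (by omega), if_neg (by omega), show (4 * j + 2) / 4 = j by omega]
  simp only [e1, e2, e3]
  rw [show 2 * ((ts.task k).m - 1) = 2 * (ts.task k).m - 2 by omega]
  congr 1
  abel

end Response
end Run.Legal

theorem coe_sum_ereal {ι : Type*} (s : Finset ι) (f : ι → ℝ) :
    ((∑ i ∈ s, f i : ℝ) : EReal) = ∑ i ∈ s, (f i : EReal) :=
  map_sum (⟨⟨Real.toEReal, EReal.coe_zero⟩, EReal.coe_add⟩ : ℝ →+ EReal) f s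

namespace Run.Legal

variable {n : ℕ} {σ : Run n} {ts : TaskSet n} {GN : Fin n → ℕ} (hσ : σ.Legal ts GN)
include hσ

/-! ### The bound `R2up` and the deadline -/

section Response

variable (hg : ∀ i, 1 ≤ GN i) {k : Fin n}
  (hdl : ∀ i ∈ ts.hp k, ∀ q, σ.jobFinish ts GN i q ≤ σ.release i q + ((ts.task i).D : EReal))
  (hd : ∀ i ∈ ts.hp k, (ts.task i).demand (GN i) ≤ (ts.task i).D)
include hg hdl hd

/-- The fixed-point argument for the window from the start of the job. Time outside higher-priority
CPU work is charged to the position in progress: a CPU segment uses at most its length, any other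
segment at most its own response time bound. -/
theorem jobFinish_le_add_R2up (q : ℕ) :
    σ.jobFinish ts GN k q ≤ σ.avail ts GN (k, q, 0) + ts.R2up GN k := by
  have hm := (ts.task k).one_le_m
  have hav : ∀ p ≤ 4 * ((ts.task k).m - 1) + 1, σ.avail ts GN (k, q, p) ≠ ⊥ := fun p hp =>
    (EReal.bot_lt_zero.trans_le (hσ.avail_nonneg hg hp)).ne'
  refine le_add_leastSolution (hσ.avail_nonneg hg (Nat.zero_le _)) fun r hr hF => ?_
  -- the bounds on the memory copies are finite
  obtain ⟨μ, hμ⟩ : ∃ μ : ℕ → ℝ, ∀ j < 2 * (ts.task k).m - 2, ts.MRup GN k j = (μ j : EReal) := by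
    refine ⟨fun j => (ts.MRup GN k j).toReal, fun j hj => (EReal.coe_toReal ?_ ?_).symm⟩
    · intro htop
      have h1 : ∑ j ∈ range (2 * (ts.task k).m - 2), ts.MRup GN k j = ⊤ := by
        refine top_le_iff.mp (htop ▸ ?_)
        exact single_le_sum (f := fun j => ts.MRup GN k j) (fun i _ => leastSolution_nonneg _)
          (mem_range.mpr hj)
      rw [h1, ← coe_sum_ereal, EReal.coe_add_top, EReal.top_add_coe] at hF
      exact EReal.coe_ne_top _ hF
    · exact (EReal.bot_lt_zero.trans_le (leastSolution_nonneg _)).ne'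
  rw [sum_congr rfl fun j hj => hμ j (mem_range.mp hj), ← coe_sum_ereal, ← coe_sum_ereal,
    ← EReal.coe_add, ← EReal.coe_add, EReal.coe_eq_coe_iff] at hF
  by_contra hlt
  rw [not_le] at hlt
  obtain ⟨b, hb⟩ : ∃ b : ℝ, (b : EReal) = σ.avail ts GN (k, q, 0) :=
    ⟨_, EReal.coe_toReal (fun h => by rw [h] at hlt; simp at hlt) (hav 0 (Nat.zero_le _))⟩
  rw [← hb, ← EReal.coe_add] at hlt
  set c := b + r with hc
  set X := ts.hpBusy σ.cpu k with hX
  set w : ℕ → ℝ := fun p => if p % 4 = 0 then (ts.task k).CLup (p / 4)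
    else if p % 2 = 1 then μ (p / 2) else (ts.task k).GRup (GN k) (p / 4) with hw
  have hstep : ∀ p ≤ 4 * ((ts.task k).m - 1), p % 4 ≠ 0 →
      σ.finish ts GN (k, q, p) ≤ σ.avail ts GN (k, q, p) + (w p : EReal) := by
    intro p hp h1
    simp only [hw]
    rw [if_neg h1]
    split_ifs with h2
    · have := hσ.finish_le_add_MRup hg hdl hd (q := q) (j := p / 2) (by omega)
      rwa [show 2 * (p / 2) + 1 = p by omega, hμ _ (by omega)] at this
    · have := hσ.finish_le_add_GRup hg (k := k) (q := q) (j := p / 4) (by omega)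
      rwa [show 4 * (p / 4) + 2 = p by omega] at this
  have hdiff : ∀ x y : ℝ, x ≤ y → volume.real (Set.Ico x y \ X) ≤ y - x := fun x y hxy =>
    (measureReal_mono Set.sdiff_subset (by simp)).trans (Real.volume_real_Ico_of_le hxy).le
  have full : ∀ p ≤ 4 * ((ts.task k).m - 1), ∀ x y : ℝ, (x : EReal) = σ.avail ts GN (k, q, p) →
      (y : EReal) = σ.finish ts GN (k, q, p) → volume.real (Set.Ico x y \ X) ≤ w p := by
    intro p hp x y hx hy
    by_cases h1 : p % 4 = 0
    · simp only [hw]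
      rw [if_pos h1]
      exact hσ.cpu_busy_le h1 hp hx hy
    · have h2 := hstep p hp h1
      have h3 := hσ.avail_le_finish hg (i := k) (q := q) hp
      rw [← hx, ← hy] at h3
      rw [← hx, ← hy, ← EReal.coe_add, EReal.coe_le_coe_iff] at h2
      linarith [hdiff x y (EReal.coe_le_coe_iff.mp h3)]
  have part : ∀ p ≤ 4 * ((ts.task k).m - 1), ∀ x : ℝ, (x : EReal) = σ.avail ts GN (k, q, p) →
      x ≤ c → (c : EReal) < σ.finish ts GN (k, q, p) → volume.real (Set.Ico x c \ X) < w p := by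
    intro p hp x hx hxc hcf
    by_cases h1 : p % 4 = 0
    · simp only [hw]
      rw [if_pos h1]
      exact hσ.cpu_busy_lt h1 hp hx hxc hcf
    · have h2 := hcf.trans_le (hstep p hp h1)
      rw [← hx, ← EReal.coe_add, EReal.coe_lt_coe_iff] at h2
      linarith [hdiff x c hxc]
  have hsplit : ∀ x y z : ℝ, volume.real (Set.Ico x z \ X)
      ≤ volume.real (Set.Ico x y \ X) + volume.real (Set.Ico y z \ X) := fun x y z => by
    have hfin : ∀ x y : ℝ, volume (Set.Ico x y \ X) ≠ ⊤ := fun x y =>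
      ne_top_of_le_ne_top (by simp : volume (Set.Ico x y) ≠ ⊤) (measure_mono Set.sdiff_subset)
    refine (measureReal_mono ?_ (measure_union_ne_top (hfin _ _) (hfin _ _))).trans
      (measureReal_union_le _ _)
    rintro u ⟨⟨h1, h2⟩, h3⟩
    rcases lt_or_ge u y with h | h
    · exact Or.inl ⟨⟨h1, h⟩, h3⟩
    · exact Or.inr ⟨⟨h, h2⟩, h3⟩
  have acc : ∀ p ≤ 4 * ((ts.task k).m - 1) + 1, ∀ x : ℝ, (x : EReal) = σ.avail ts GN (k, q, p) →
      volume.real (Set.Ico b x \ X) ≤ ∑ p' ∈ range p, w p' := by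
    intro p
    induction p with
    | zero =>
      intro _ x hx
      rw [← hb, EReal.coe_eq_coe_iff] at hx
      simp [hx]
    | succ p ih =>
      intro hp y hy
      have hle : σ.avail ts GN (k, q, p) ≤ (y : EReal) := by
        rw [hy]; exact hσ.avail_le_finish hg (Nat.le_of_succ_le_succ hp)
      have hx : (((σ.avail ts GN (k, q, p)).toReal : ℝ) : EReal) = σ.avail ts GN (k, q, p) :=
        EReal.coe_toReal (hle.trans_lt (EReal.coe_lt_top y)).ne (hav p (by omega))
      have h1 := ih (by omega) _ hx
      have h2 := full p (by omega) _ y hx hy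
      rw [sum_range_succ]
      linarith [hsplit b (σ.avail ts GN (k, q, p)).toReal y]
  have wnn : ∀ p ∈ range (4 * ((ts.task k).m - 1) + 1), 0 ≤ w p := by
    intro p hp
    rw [mem_range] at hp
    simp only [hw]
    split_ifs with h1 h2
    · exact (ts.task k).CLup_nonneg (by omega)
    · rw [← EReal.coe_nonneg, ← hμ _ (by omega)]
      exact leastSolution_nonneg _
    · exact ((ts.task k).GRlo_nonneg (by omega)).trans ((hσ.GRlo_le_gpuTime hg (q := q)
        (by omega)).trans (hσ.gpuTime_le_GRup hg (by omega)))
  have hbc : b ≤ c := by linarith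
  -- The position in progress at `c`. Earlier positions are charged in full by `acc`; this one is
  -- charged strictly less than `w p` by `part`, which gives the contradiction.
  obtain ⟨p, hp, hpc, hcp⟩ : ∃ p ≤ 4 * ((ts.task k).m - 1),
      σ.avail ts GN (k, q, p) ≤ (c : EReal) ∧ (c : EReal) < σ.finish ts GN (k, q, p) := by
    classical
    have hex : ∃ p, (c : EReal) < σ.avail ts GN (k, q, p) := ⟨_, hlt⟩
    have h1 : Nat.find hex ≠ 0 := fun h0 => by
      have := Nat.find_spec hex
      rw [h0, ← hb] at this
      exact absurd (EReal.coe_lt_coe_iff.mp this) (not_lt.mpr hbc)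
    have h2 : Nat.find hex ≤ 4 * ((ts.task k).m - 1) + 1 := Nat.find_min' hex hlt
    refine ⟨Nat.find hex - 1, by omega, not_lt.mp (Nat.find_min hex (by omega)), ?_⟩
    have := Nat.find_spec hex
    rwa [show Nat.find hex = Nat.find hex - 1 + 1 by omega] at this
  have hx : (((σ.avail ts GN (k, q, p)).toReal : ℝ) : EReal) = σ.avail ts GN (k, q, p) :=
    EReal.coe_toReal (hpc.trans_lt (EReal.coe_lt_top c)).ne (hav p (by omega))
  have t1 := acc p (by omega) _ hx
  have t2 := part p hp _ hx (by rwa [← EReal.coe_le_coe_iff, hx]) hcp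
  have t3 := hsplit b (σ.avail ts GN (k, q, p)).toReal c
  have t4 : ∑ p' ∈ range (p + 1), w p' ≤ ∑ p' ∈ range (4 * ((ts.task k).m - 1) + 1), w p' :=
    sum_le_sum_of_subset_of_nonneg (range_mono (by omega)) fun i hi _ => wnn i hi
  rw [sum_range_succ, sum_range_positions, Nat.sub_add_cancel hm] at t4
  have e1 : ∀ j, w (4 * j) = (ts.task k).CLup j := fun j => by
    simp only [hw]
    rw [if_pos (by omega), Nat.mul_div_cancel_left j (by omega)]
  have e2 : ∀ j, w (2 * j + 1) = μ j := fun j => by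
    simp only [hw]
    rw [if_neg (by omega), if_pos (by omega), show (2 * j + 1) / 2 = j by omega]
  have e3 : ∀ j, w (4 * j + 2) = (ts.task k).GRup (GN k) j := fun j => by
    simp only [hw]
    rw [if_neg (by omega), if_neg (by omega), show (4 * j + 2) / 4 = j by omega]
  simp only [e1, e2, e3] at t4
  rw [show 2 * ((ts.task k).m - 1) = 2 * (ts.task k).m - 2 by omega] at t4
  have t5 := hσ.hp_cpu_le hg hdl hd b hr
  have t6 := length_le (hσ.measurableSet_hpBusy_cpu k) hbc
  linarith

/-- The response bounds count from the start of the job, which is its release because the previous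
job met its deadline and `D ≤ T`. -/
theorem jobFinish_le_release_add_D (hR : ts.Rup GN k ≤ ((ts.task k).D : EReal)) (q : ℕ) :
    σ.jobFinish ts GN k q ≤ σ.release k q + ((ts.task k).D : EReal) := by
  have hfin : ∀ q, σ.jobFinish ts GN k q ≤ σ.avail ts GN (k, q, 0) + ((ts.task k).D : EReal) := by
    intro q
    rcases min_le_iff.mp hR with h | h
    · exact (hσ.jobFinish_le_add_R1up hg hdl hd q).trans (add_le_add_right h _)
    · exact (hσ.jobFinish_le_add_R2up hg hdl hd q).trans (add_le_add_right h _)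
  induction q with
  | zero => exact hfin 0
  | succ q ih =>
    have h1 : σ.avail ts GN (k, q + 1, 0) ≤ σ.release k (q + 1) := by
      refine max_le le_rfl (ih.trans (le_trans ?_ (hσ.sporadic k q)))
      exact add_le_add_right (EReal.coe_le_coe_iff.mpr (ts.task k).D_le_T) _
    exact (hfin (q + 1)).trans (add_le_add_left h1 _)

end Response
end Run.Legal

/-! ### A run in which only one job is released -/

section Solo

variable {n : ℕ} (ts : TaskSet n) (GN : Fin n → ℕ) (i : Fin n)

/-- Length of the segment at position `p` in the run with a single job of the task `i`. -/
def soloLength (p : ℕ) : ℝ :=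
  if p % 4 = 0 then (ts.task i).CLup (p / 4)
  else if p % 2 = 1 then (ts.task i).MLup (p / 2) else (ts.task i).GRlo (GN i) (p / 4)

/-- Start of the segment at position `p` in the run with a single job of the task `i`. -/
def soloStart (p : ℕ) : ℝ := ∑ p' ∈ range p, soloLength ts GN i p'

/-- The position `p` is of a kind in `P` and it is executed at time `u`. -/
def SoloAt (P : ℕ → Prop) (u : ℝ) (p : ℕ) : Prop :=
  p ≤ 4 * ((ts.task i).m - 1) ∧ P p ∧ soloStart ts GN i p ≤ u ∧ u < soloStart ts GN i (p + 1)

open Classical in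
/-- The schedule of the segments of a kind `P` in the run with a single job. -/
def soloRes (P : ℕ → Prop) (u : ℝ) : Option (Seg n) :=
  if h : ∃ p, SoloAt ts GN i P u p then some (i, 0, h.choose) else none

open Classical in
/-- The run with a single job of the task `i`, released at time `0`. -/
def soloRun : Run n where
  release j q := if j = i ∧ q = 0 then 0 else ⊤
  cpuTime j _ l := (ts.task j).CLup l
  copyTime j _ l := (ts.task j).MLup l
  gpuWork j _ l := (ts.task j).GWlo l
  gpuOverhead _ _ _ := 0
  gpuRatio _ _ _ := 1
  cpu := soloRes ts GN i fun p => p % 4 = 0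
  bus := soloRes ts GN i fun p => p % 2 = 1

variable {ts GN i}

theorem soloLength_nonneg {p : ℕ} (hp : p ≤ 4 * ((ts.task i).m - 1)) :
    0 ≤ soloLength ts GN i p := by
  have := (ts.task i).one_le_m
  unfold soloLength
  split_ifs with h1 h2
  · exact (ts.task i).CLup_nonneg (by omega)
  · exact (ts.task i).MLup_nonneg (by omega)
  · exact (ts.task i).GRlo_nonneg (by omega)

theorem soloStart_mono {p p' : ℕ} (h : p ≤ p') (hp : p' ≤ 4 * ((ts.task i).m - 1) + 1) :
    soloStart ts GN i p ≤ soloStart ts GN i p' :=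
  sum_le_sum_of_subset_of_nonneg (range_mono h) fun j hj _ =>
    soloLength_nonneg (by rw [mem_range] at hj; omega)

theorem SoloAt.unique {P P' : ℕ → Prop} {u : ℝ} {p p' : ℕ} (h : SoloAt ts GN i P u p)
    (h' : SoloAt ts GN i P' u p') : p = p' := by
  obtain ⟨a1, -, a2, a3⟩ := h
  obtain ⟨b1, -, b2, b3⟩ := h'
  rcases lt_trichotomy p p' with h | h | h
  · linarith [soloStart_mono (ts := ts) (GN := GN) (i := i) (p := p + 1) (p' := p') h (by omega)]
  · exact h
  · linarith [soloStart_mono (ts := ts) (GN := GN) (i := i) (p := p' + 1) (p' := p) h (by omega)]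

theorem soloRes_eq_some {P : ℕ → Prop} {u : ℝ} {s : Seg n} :
    soloRes ts GN i P u = some s ↔ s.1 = i ∧ s.2.1 = 0 ∧ SoloAt ts GN i P u s.2.2 := by
  obtain ⟨j, q, p⟩ := s
  unfold soloRes
  split_ifs with h
  · simp only [Option.some.injEq, Prod.mk.injEq]
    constructor
    · rintro ⟨rfl, rfl, rfl⟩
      exact ⟨rfl, rfl, h.choose_spec⟩
    · rintro ⟨rfl, rfl, h3⟩
      exact ⟨rfl, rfl, h.choose_spec.unique h3⟩
  · simp only [false_iff]
    rintro ⟨-, -, h3⟩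
    exact h ⟨_, h3⟩

theorem soloRes_setOf {P : ℕ → Prop} (s : Seg n) : {u : ℝ | soloRes ts GN i P u = some s} = ∅ ∨
    {u : ℝ | soloRes ts GN i P u = some s}
      = Set.Ico (soloStart ts GN i s.2.2) (soloStart ts GN i (s.2.2 + 1)) := by
  by_cases h : s.1 = i ∧ s.2.1 = 0 ∧ s.2.2 ≤ 4 * ((ts.task i).m - 1) ∧ P s.2.2
  · right
    ext u
    rw [Set.mem_ofPred_eq, soloRes_eq_some]
    exact ⟨fun h' => h'.2.2.2.2, fun h' => ⟨h.1, h.2.1, h.2.2.1, h.2.2.2, h'⟩⟩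
  · left
    refine Set.eq_empty_of_forall_notMem fun u hu => h ?_
    rw [Set.mem_ofPred_eq, soloRes_eq_some] at hu
    exact ⟨hu.1, hu.2.1, hu.2.2.1, hu.2.2.2.1⟩

theorem serviceEnd_of_eq_Ico {res : ℝ → Option (Seg n)} {s : Seg n} {x e : ℝ} (he : 0 ≤ e)
    (h : ∀ u, res u = some s ↔ x ≤ u ∧ u < x + e) :
    serviceEnd res s (x : EReal) e = ((x + e : ℝ) : EReal) := by
  refine le_antisymm (sInf_le ⟨EReal.coe_le_coe_iff.mpr (by linarith), x + e, rfl, ?_⟩) ?_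
  · have : {u : ℝ | u < x + e ∧ res u = some s} = Set.Ico x (x + e) := by
      ext u
      rw [Set.mem_ofPred_eq, h, Set.mem_Ico]
      tauto
    rw [this, Real.volume_Ico, add_sub_cancel_left]
  · rw [EReal.coe_add]
    exact add_le_serviceEnd fun u hu => EReal.coe_le_coe_iff.mpr ((h u).mp hu).1

theorem serviceEnd_top {res : ℝ → Option (Seg n)} {s : Seg n} {e : ℝ} :
    serviceEnd res s ⊤ e = ⊤ :=
  top_le_iff.mp le_serviceEnd

theorem soloRun_segEnd_top {j : Fin n} {q p : ℕ} : (soloRun ts GN i).segEnd GN j q p ⊤ = ⊤ := by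
  unfold Run.segEnd
  split_ifs
  · exact serviceEnd_top
  · exact serviceEnd_top
  · exact EReal.top_add_coe _
  · exact serviceEnd_top

theorem soloRun_avail_top {j : Fin n} {q p : ℕ} (h : ¬(j = i ∧ q = 0)) :
    (soloRun ts GN i).avail ts GN (j, q, p) = ⊤ := by
  induction p with
  | zero =>
    refine top_le_iff.mp (le_trans (le_of_eq ?_) Run.Legal.release_le_avail)
    exact (if_neg h).symm
  | succ p ih =>
    change (soloRun ts GN i).segEnd GN j q p ((soloRun ts GN i).avail ts GN (j, q, p)) = ⊤
    rw [ih, soloRun_segEnd_top]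

theorem soloRun_avail {p : ℕ} (hp : p ≤ 4 * ((ts.task i).m - 1) + 1) :
    (soloRun ts GN i).avail ts GN (i, 0, p) = (soloStart ts GN i p : ℝ) := by
  induction p with
  | zero =>
    change (if i = i ∧ 0 = 0 then (0 : EReal) else ⊤) = _
    simp [soloStart]
  | succ p ih =>
    have h0 := soloLength_nonneg (GN := GN) (Nat.le_of_succ_le_succ hp)
    have hsucc : soloStart ts GN i (p + 1) = soloStart ts GN i p + soloLength ts GN i p :=
      sum_range_succ _ _
    have hres : ∀ {P : ℕ → Prop}, P p → ∀ u, soloRes ts GN i P u = some (i, 0, p) ↔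
        soloStart ts GN i p ≤ u ∧ u < soloStart ts GN i p + soloLength ts GN i p := by
      intro P hP u
      rw [soloRes_eq_some, ← hsucc]
      exact ⟨fun h => h.2.2.2.2, fun h => ⟨rfl, rfl, by dsimp only; omega, hP, h⟩⟩
    change (soloRun ts GN i).finish ts GN (i, 0, p) = _
    rw [hsucc]
    rcases (by omega : p % 4 = 0 ∨ p % 2 = 1 ∨ p % 4 = 2) with h | h | h
    · have hl : soloLength ts GN i p = (soloRun ts GN i).cpuTime i 0 (p / 4) := if_pos h
      rw [Run.finish_cpu h, ih (by omega), ← hl]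
      exact serviceEnd_of_eq_Ico h0 (hres h)
    · have hl : soloLength ts GN i p = (soloRun ts GN i).copyTime i 0 (p / 2) := by
        rw [soloLength, if_neg (by omega), if_pos h]; rfl
      rw [Run.finish_bus h, ih (by omega), ← hl]
      exact serviceEnd_of_eq_Ico h0 (hres h)
    · have hl : soloLength ts GN i p = (soloRun ts GN i).gpuTime GN i 0 (p / 4) := by
        rw [soloLength, if_neg (by omega), if_neg (by omega)]
        simp [Run.gpuTime, soloRun, Task.GRlo]
      rw [Run.finish_gpu h, ih (by omega), ← hl, EReal.coe_add]

theorem soloRun_pending {s : Seg n} {u : ℝ} : (soloRun ts GN i).Pending ts GN s u ↔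
    s.1 = i ∧ s.2.1 = 0 ∧ SoloAt ts GN i (fun _ => True) u s.2.2 := by
  obtain ⟨j, q, p⟩ := s
  by_cases h : j = i ∧ q = 0
  · obtain ⟨rfl, rfl⟩ := h
    unfold Run.Pending Run.finish SoloAt
    dsimp only
    constructor
    · rintro ⟨h1, h2, h3⟩
      rw [soloRun_avail (by omega), EReal.coe_le_coe_iff] at h2
      rw [soloRun_avail (by omega), EReal.coe_lt_coe_iff] at h3
      exact ⟨rfl, rfl, h1, trivial, h2, h3⟩
    · rintro ⟨-, -, h1, -, h2, h3⟩
      rw [soloRun_avail (by omega), soloRun_avail (by omega), EReal.coe_le_coe_iff,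
        EReal.coe_lt_coe_iff]
      exact ⟨h1, h2, h3⟩
  · refine ⟨fun h' => ?_, fun h' => absurd ⟨h'.1, h'.2.1⟩ h⟩
    have := h'.2.1
    rw [soloRun_avail_top h] at this
    simp at this

/-- With a single job there is no contention: by `soloRun_pending` each resource executes its
segment exactly while it is pending, so the scheduling rules hold and priority inversion cannot
occur. -/
theorem soloRun_legal : (soloRun ts GN i).Legal ts GN where
  release_nonneg j := by
    change (0 : EReal) ≤ if _ then 0 else ⊤
    split_ifs <;> simp
  sporadic j q := by
    refine le_top.trans (le_of_eq (if_neg ?_).symm)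
    omega
  cpuTime_mem j _ l hl := ⟨(ts.task j).CL_le l hl, le_rfl⟩
  copyTime_mem j _ l hl := ⟨(ts.task j).ML_le l hl, le_rfl⟩
  gpuWork_mem j _ l hl := ⟨le_rfl, (ts.task j).GW_le l hl⟩
  gpuOverhead_mem j _ l hl := ⟨le_rfl, (ts.task j).GL_nonneg l hl⟩
  gpuRatio_mem j _ l hl := ⟨le_rfl, (ts.task j).one_le_α l hl⟩
  cpu_measurable s := by
    rcases soloRes_setOf (ts := ts) (GN := GN) (i := i) (P := fun p => p % 4 = 0) s with h | h
    · exact h ▸ MeasurableSet.empty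
    · exact h ▸ measurableSet_Ico
  bus_measurable s := by
    rcases soloRes_setOf (ts := ts) (GN := GN) (i := i) (P := fun p => p % 2 = 1) s with h | h
    · exact h ▸ MeasurableSet.empty
    · exact h ▸ measurableSet_Ico
  cpu_pending u s h := by
    obtain ⟨h1, h2, h3, h4, h5⟩ := soloRes_eq_some.mp h
    exact ⟨h4, soloRun_pending.mpr ⟨h1, h2, h3, trivial, h5⟩⟩
  cpu_priority u s hs h := by
    obtain ⟨h1, h2, h3, -, h5⟩ := soloRun_pending.mp h
    exact ⟨s, soloRes_eq_some.mpr ⟨h1, h2, h3, hs, h5⟩, Or.inl rfl⟩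
  bus_pending u s h := by
    obtain ⟨h1, h2, h3, h4, h5⟩ := soloRes_eq_some.mp h
    exact ⟨h4, soloRun_pending.mpr ⟨h1, h2, h3, trivial, h5⟩⟩
  bus_busy u s hs h := by
    obtain ⟨h1, h2, h3, -, h5⟩ := soloRun_pending.mp h
    exact ⟨s, soloRes_eq_some.mpr ⟨h1, h2, h3, hs, h5⟩⟩
  bus_nonpreemptive u v s h _ hv := by
    obtain ⟨h1, h2, h3, -, h5⟩ := soloRun_pending.mp hv
    exact soloRes_eq_some.mpr ⟨h1, h2, h3, (soloRes_eq_some.mp h).2.2.2.1, h5⟩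
  bus_priority u s s' _ h h' hlt := by
    rw [(soloRun_pending.mp h).1, (soloRes_eq_some.mp h').1] at hlt
    exact absurd hlt (lt_irrefl _)

/-- The single job of `soloRun` finishes exactly after its demand, and schedulability applies to
this run. Its GPU segments have minimal work, no overhead and ratio `1`, because the gaps contain
`GRlo`. -/
theorem demand_le_of_schedulable (h : ts.Schedulable GN i) :
    (ts.task i).demand (GN i) ≤ (ts.task i).D := by
  have hm := (ts.task i).one_le_m
  have h1 := h (soloRun ts GN i) soloRun_legal 0
  have h2 : (soloRun ts GN i).jobFinish ts GN i 0
      = (soloStart ts GN i (4 * ((ts.task i).m - 1) + 1) : ℝ) := soloRun_avail le_rfl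
  have h3 : (soloRun ts GN i).release i 0 = 0 := if_pos ⟨rfl, rfl⟩
  rw [h2, h3, zero_add, EReal.coe_le_coe_iff, soloStart, sum_range_positions,
    Nat.sub_add_cancel hm] at h1
  refine le_trans (le_of_eq ?_) h1
  rw [Task.demand, show 2 * ((ts.task i).m - 1) = 2 * (ts.task i).m - 2 by omega]
  congr 1
  · congr 1
    · refine sum_congr rfl fun j _ => ?_
      rw [soloLength, if_pos (by omega), Nat.mul_div_cancel_left j (by omega)]
    · refine sum_congr rfl fun j _ => ?_
      rw [soloLength, if_neg (by omega), if_pos (by omega), show (2 * j + 1) / 2 = j by omega]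
  · refine sum_congr rfl fun j _ => ?_
    rw [soloLength, if_neg (by omega), if_neg (by omega), show (4 * j + 2) / 4 = j by omega]

end Solo

/-! ### Schedulability -/

namespace TaskSet

variable {n : ℕ} {ts : TaskSet n} {GN : Fin n → ℕ}

theorem schedulable_of_hp (hg : ∀ i, 1 ≤ GN i) {k : Fin n}
    (hhp : ∀ i ∈ ts.hp k, ts.Schedulable GN i) (hR : ts.Rup GN k ≤ ((ts.task k).D : EReal)) :
    ts.Schedulable GN k := fun σ hσ q =>
  hσ.jobFinish_le_release_add_D hg (fun i hi q => hhp i hi σ hσ q)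
    (fun i hi => demand_le_of_schedulable (hhp i hi)) hR q

/-- Strong induction on the priority: higher-priority tasks of a member of `hp k` lie in `hp k`
again, so the hypothesis is inherited. -/
theorem schedulable_of_Rup_le (hg : ∀ i, 1 ≤ GN i) {k : Fin n}
    (hR : ∀ i, i = k ∨ i ∈ ts.hp k → ts.Rup GN i ≤ ((ts.task i).D : EReal)) :
    ts.Schedulable GN k := by
  induction h : ts.prio k using Nat.strong_induction_on generalizing k with
  | _ p ih =>
    refine schedulable_of_hp hg (fun i hi => ?_) (hR k (Or.inl rfl))
    have hlt : ts.prio i < ts.prio k := by simpa [hp] using hi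
    refine ih _ (h ▸ hlt) (fun j hj => hR j (Or.inr ?_)) rfl
    rcases hj with rfl | hj
    · exact hi
    · have : ts.prio j < ts.prio i := by simpa [hp] using hj
      simpa [hp] using this.trans hlt

theorem sum_le_of_mem_grid {N : ℕ} (h : GN ∈ grid n N) : ∑ i, GN i ≤ N := by
  cases n with
  | zero => simp
  | succ n =>
    -- The constraint of the last task bounds the sum over all tasks.
    refine le_trans (le_of_eq ?_) (h (Fin.last n)).2
    rw [← sum_erase_add _ _ (mem_univ (Fin.last n))]
    congr 1
    refine sum_congr ?_ fun _ _ => rfl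
    ext j
    simp [Fin.lt_last_iff_ne_last]

end TaskSet

end RTGPU

end

theorem mainTheorem2 {n : ℕ} (ts : RTGPU.TaskSet n) (N : ℕ) :
    (∀ GN : Fin n → ℕ, (∀ i, 1 ≤ GN i) → ∑ i, GN i ≤ N → ∀ k : Fin n,
      ((∀ i ∈ ts.hp k, ts.Schedulable GN i) →
        ts.Rup GN k ≤ ((ts.task k).D : EReal) → ts.Schedulable GN k) ∧
      ((∀ i, i = k ∨ i ∈ ts.hp k → ts.Rup GN i ≤ ((ts.task i).D : EReal)) →
        ts.Schedulable GN k)) ∧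
    (∀ GN ∈ RTGPU.TaskSet.grid n N, ts.Passes GN →
      (∀ i, 1 ≤ GN i) ∧ ∑ i, GN i ≤ N ∧ ∀ k : Fin n, ts.Schedulable GN k) := by
  refine ⟨fun GN hg _ k => ⟨RTGPU.TaskSet.schedulable_of_hp hg,
    RTGPU.TaskSet.schedulable_of_Rup_le hg⟩, fun GN hGN hpass => ?_⟩
  have hg : ∀ i, 1 ≤ GN i := fun i => (hGN i).1
  exact ⟨hg, RTGPU.TaskSet.sum_le_of_mem_grid hGN, fun k =>
    RTGPU.TaskSet.schedulable_of_Rup_le hg fun i _ => hpass i⟩
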